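/- Let $(\Omega,\mathcal F,P)$ be a probability space and let $L$ be an integrable random variable with distribution function $F_L(x)=P[L\le x]$. Set $\hat x:=\sup\{m\in\mathbb R: F_L(m)<1\}\in(-\infty,\infty]$ and assume $0<\hat x\le\infty$. Define - $q_\alpha(L)=\inf\{m: F_L(m)\ge 1-\alpha\}$ and $ES_\alpha(L)=\frac1\alpha\int_0^\alpha q_u(L)\,du$ for $0<\alpha<1$; - for $0<\alpha\le 1/2$, $e_\alpha(L)$ as the unique real $m$ with $(1-\alpha)E[(L-m)^+]=\alpha E[(L-m)^-]$, $tce_\alpha(L)=E[L\mid L>e_\alpha(L)]$ and $es_\alpha(L)=\frac1\alpha\int_0^\alpha e_u(L)\,du$. Say that $F_L$ is in $MDA(H)$ if there are constants $c_n>0$, $d_n\in\mathbb R$ with $\lim_{n\to\infty}F_L(c_nx+d_n)^n=H(x)$ for all $x\in\mathbb R$. Let $\Phi_\eta(x)=\exp(-x^{-\eta})$ for $x>0$ and $0$ for $x\le 0$; $\Psi_\eta(x)=\exp(-(-x)^\eta)$ for $x<0$ and $1$ for $x\ge 0$; $\Lambda(x)=\exp(-e^{-x})$. A measurable $r:\mathbb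 R\to\mathbb R$ is slowly varying if $\lim_{t\to\infty}r(tx)/r(t)=1$ for every $x>0$. All relations $\sim$ and $o(1)$ below are for $\alpha\downarrow 0$. (i) (Fréchet) If $F_L\in MDA(\Phi_\eta)$ with $\eta>1$, then $u\mapsto e_u(L)$ is integrable on $(0,1/2]$ (so $es_\alpha(L)$ is finite) and $$es_\alpha(L)\sim tce_\alpha(L)\sim(\eta-1)^{-1/\eta}ES_\alpha(L),\qquad \frac{tce_\alpha(L)}{e_\alpha(L)}\sim\frac{ES_\alpha(L)}{q_\alpha(L)}.$$ (ii) (Weibull) If $F_L\in MDA(\Psi_\eta)$ with $\eta>0$, then $\hat x<\infty$, $u\mapsto e_u(L)$ is integrable on $(0,1/2]$, and $$\frac{\hat x-ES_\alpha(L)}{\hat x-es_\alpha(L)}=o(1),\qquad \frac{\hat x-tce_\alpha(L)}{\hat x-e_\alpha(L)}\sim\frac{\hat x-ES_\alpha(L)}{\hat x-q_\alpha(L)}.$$ (iii) (Gumbel) If $F_L\in MDA(\Lambda)$, then $$\frac{tce_\alpha(L)}{e_\alpha(L)}\sim\frac{ES_\alpha(L)}{q_\alpha(L)}\ \text{ if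 }\hat x=\infty,\qquad \frac{\hat x-tce_\alpha(L)}{\hat x-e_\alpha(L)}\sim\frac{\hat x-ES_\alpha(L)}{\hat x-q_\alpha(L)}\ \text{ if }\hat x<\infty.$$ If in addition $F_L(x)=1-\exp(-x^\tau r(x))$ for all sufficiently large $x$, with a constant $\tau>0$ and a slowly varying function $r$ such that $$\lim_{x\to\infty}\Big(\frac{r(cx)}{r(x)}-1\Big)\ln r(x)=0\quad\text{for some constant }c>0,$$ then $u\mapsto e_u(L)$ is integrable on $(0,1/2]$ and $$es_\alpha(L)\sim tce_\alpha(L)\sim ES_\alpha(L).$$ -/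

import Mathlib

open MeasureTheory Filter Topology Asymptotics

namespace ExpectileRisk

variable {Ω : Type*} [MeasurableSpace Ω]

/-- The cumulative distribution function `F_L` of the loss profile `L`. -/
noncomputable def lossCDF (P : Measure Ω) (L : Ω → ℝ) (x : ℝ) : ℝ :=
  ProbabilityTheory.cdf (P.map L) x

/-- The right endpoint `x̂ = sup {m ∈ ℝ : F m < 1}`, as an extended real number. -/
noncomputable def rightEndpoint (F : ℝ → ℝ) : EReal :=
  sSup ((fun m : ℝ => (m : EReal)) '' {m : ℝ | F m < 1})

/-- Value at risk `q_α(L) = inf {m : F_L(m) ≥ 1 - α}`. -/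
noncomputable def quantile (P : Measure Ω) (L : Ω → ℝ) (α : ℝ) : ℝ :=
  sInf {m : ℝ | lossCDF P L m ≥ 1 - α}

/-- Expected shortfall `ES_α(L) = (1/α) ∫_0^α q_u(L) du`. -/
noncomputable def expectedShortfall (P : Measure Ω) (L : Ω → ℝ) (α : ℝ) : ℝ :=
  (1 / α) * ∫ u in (0 : ℝ)..α, quantile P L u

/-- The defining equation of the `α`-expectile:
`(1 - α) E[(L - m)⁺] = α E[(L - m)⁻]`. -/
def IsExpectile (P : Measure Ω) (L : Ω → ℝ) (α m : ℝ) : Prop :=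
  (1 - α) * ∫ ω, (L ω - m)⁺ ∂P = α * ∫ ω, (L ω - m)⁻ ∂P

/-- The expectile `e_α(L)`: the solution of its defining equation, which exists and is unique
for integrable `L` and `0 < α ≤ 1/2` (see `existsUnique_isExpectile`). -/
noncomputable def expectile (P : Measure Ω) (L : Ω → ℝ) (α : ℝ) : ℝ :=
  Classical.epsilon (IsExpectile P L α)

/-- Expectile based tail conditional expectation `tce_α(L) = E[L | L > e_α(L)]`. -/
noncomputable def expectileTCE (P : Measure Ω) (L : Ω → ℝ) (α : ℝ) : ℝ :=
  ∫ ω, L ω ∂(ProbabilityTheory.cond P {ω | expectile P L α < L ω})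

/-- Expectile based expected shortfall `es_α(L) = (1/α) ∫_0^α e_u(L) du`. -/
noncomputable def expectileES (P : Measure Ω) (L : Ω → ℝ) (α : ℝ) : ℝ :=
  (1 / α) * ∫ u in (0 : ℝ)..α, expectile P L u

/-- `F` is in the maximum domain of attraction `MDA(H)`: there are `c_n > 0` and `d_n` with
`F(c_n x + d_n)^n → H(x)`. (The limits `H` below are continuous, so that weak convergence is
convergence at every `x`.) -/
def MDA (F H : ℝ → ℝ) : Prop :=
  ∃ c d : ℕ → ℝ, (∀ n, 0 < c n) ∧
    ∀ x : ℝ, Tendsto (fun n : ℕ => F (c n * x + d n) ^ n) atTop (𝓝 (H x))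

/-- The Fréchet distribution function `Φ_η`. -/
noncomputable def frechetCDF (η x : ℝ) : ℝ :=
  if 0 < x then Real.exp (-(x ^ (-η))) else 0

/-- The Weibull extreme value distribution function `Ψ_η`. -/
noncomputable def weibullCDF (η x : ℝ) : ℝ :=
  if x < 0 then Real.exp (-((-x) ^ η)) else 1

/-- The Gumbel distribution function `Λ`. -/
noncomputable def gumbelCDF (x : ℝ) : ℝ :=
  Real.exp (-Real.exp (-x))

/-- Slowly varying (at infinity) functions. -/
def SlowlyVarying (r : ℝ → ℝ) : Prop :=
  Measurable r ∧ ∀ x : ℝ, 0 < x → Tendsto (fun t : ℝ => r (t * x) / r t) atTop (𝓝 1)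

/-- The expectile is well defined: for integrable `L` and `0 < α ≤ 1/2` its defining equation has
exactly one solution. -/
theorem existsUnique_isExpectile (P : Measure Ω) [IsProbabilityMeasure P] {L : Ω → ℝ}
    (hL : Integrable L P) {α : ℝ} (h0 : 0 < α) (h1 : α ≤ 1 / 2) :
    ∃! m : ℝ, IsExpectile P L α m := by
  have ip : ∀ m : ℝ, Integrable (fun ω => (L ω - m)⁺) P := fun m =>
    (hL.sub (integrable_const m)).pos_part
  have iq : ∀ m : ℝ, Integrable (fun ω => (L ω - m)⁻) P := fun m =>
    (hL.sub (integrable_const m)).neg_part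
  let f : ℝ → ℝ := fun m => ∫ ω, ((1 - α) * (L ω - m)⁺ - α * (L ω - m)⁻) ∂P
  have ig : ∀ m : ℝ, Integrable (fun ω => (1 - α) * (L ω - m)⁺ - α * (L ω - m)⁻) P := fun m =>
    ((ip m).const_mul _).sub ((iq m).const_mul _)
  have hf : ∀ m, IsExpectile P L α m ↔ f m = 0 := by
    intro m
    have : f m = (1 - α) * ∫ ω, (L ω - m)⁺ ∂P - α * ∫ ω, (L ω - m)⁻ ∂P := by
      simp only [f]
      rw [integral_sub ((ip m).const_mul _) ((iq m).const_mul _), integral_const_mul,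
        integral_const_mul]
    rw [this, sub_eq_zero, IsExpectile]
  have hmax : ∀ t : ℝ, (t ≤ 0 ∧ max t 0 = 0 ∧ max (-t) 0 = -t) ∨
      (0 ≤ t ∧ max t 0 = t ∧ max (-t) 0 = 0) := by
    intro t
    rcases le_total t 0 with h | h
    · exact Or.inl ⟨h, max_eq_right h, max_eq_left (by linarith)⟩
    · exact Or.inr ⟨h, max_eq_left h, max_eq_right (by linarith)⟩
  have key : ∀ m m' : ℝ, m ≤ m' →
      α * (m' - m) ≤ f m - f m' ∧ f m - f m' ≤ (1 - α) * (m' - m) := by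
    intro m m' hm
    have e : f m - f m' = ∫ ω, (((1 - α) * (L ω - m)⁺ - α * (L ω - m)⁻)
        - ((1 - α) * (L ω - m')⁺ - α * (L ω - m')⁻)) ∂P :=
      (integral_sub (ig m) (ig m')).symm
    have c : ∀ k : ℝ, ∫ _ω : Ω, k ∂P = k := by intro k; simp
    rw [e]
    constructor
    · rw [← c (α * (m' - m))]
      refine integral_mono (integrable_const _) ((ig m).sub (ig m')) fun ω => ?_
      simp only [posPart_def, negPart_def]
      obtain ⟨h, h2⟩ | ⟨h, h2⟩ := hmax (L ω - m) <;>
        obtain ⟨h', h2'⟩ | ⟨h', h2'⟩ := hmax (L ω - m') <;>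
        rw [h2.1, h2.2, h2'.1, h2'.2] <;> nlinarith
    · rw [← c ((1 - α) * (m' - m))]
      refine integral_mono ((ig m).sub (ig m')) (integrable_const _) fun ω => ?_
      simp only [posPart_def, negPart_def]
      obtain ⟨h, h2⟩ | ⟨h, h2⟩ := hmax (L ω - m) <;>
        obtain ⟨h', h2'⟩ | ⟨h', h2'⟩ := hmax (L ω - m') <;>
        rw [h2.1, h2.2, h2'.1, h2'.2] <;> nlinarith
  have hc : Continuous f := by
    refine (LipschitzWith.of_dist_le_mul (K := 1) fun x y => ?_).continuous
    simp only [Real.dist_eq, NNReal.coe_one, one_mul]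
    rcases le_total x y with h | h
    · have := key x y h
      rw [abs_of_nonneg (by nlinarith), abs_of_nonpos (by linarith)]
      nlinarith
    · have := key y x h
      rw [abs_of_nonpos (by nlinarith), abs_of_nonneg (by linarith)]
      nlinarith
  obtain ⟨m, hm⟩ : ∃ m, f m = 0 := by
    have ha : (0 : ℝ) ≤ |f 0| / α := by positivity
    have hb : α * (|f 0| / α) = |f 0| := by field_simp
    have k1 := (key (-(|f 0| / α)) 0 (by linarith)).1
    have k2 := (key 0 (|f 0| / α) ha).1
    have := intermediate_value_Icc' (by linarith : -(|f 0| / α) ≤ |f 0| / α) hc.continuousOn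
    obtain ⟨m, -, hm⟩ := this (show (0 : ℝ) ∈ Set.Icc _ _ from
      ⟨by linarith [le_abs_self (f 0)], by linarith [neg_abs_le (f 0)]⟩)
    exact ⟨m, hm⟩
  refine ⟨m, (hf m).2 hm, fun y hy => ?_⟩
  have hy' := (hf y).1 hy
  rcases le_total y m with h | h
  · have := (key y m h).1
    nlinarith
  · have := (key m y h).1
    nlinarith

end ExpectileRisk

open ExpectileRisk

/-! Write `G` for the tail `P[L > m]` and `π(m) = E[(L - m)⁺] = ∫_m^∞ G` for the stop-loss
transform. Everything is expressed through these two: `ES_α = q + π(q)/α` with `q = q_α` by layer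
cake, `tce_α = e + π(e)/G(e)` with `e = e_α`, and the equation of the expectile becomes `(1 - 2α)
π(e) = α (e - E[L])`. Membership in a domain of attraction makes `G` regularly or rapidly varying at
the endpoint and gives `G(q_α) ~ α`.

Karamata's theorem then yields a constant `β`, the limit of `π(t)/(t G(t))` when the endpoint is
infinite and of `π(t)/((x - t) G(t))` when it is a real `x`: `β = 1/(η-1)` for Fréchet, `1/(η+1)`
for Weibull and `0` for Gumbel. Both `tce/e` and `ES/q` tend to `1 + β`; in the bounded case the two
ratios of distances to `x` tend to `1 - β`. As these limits are nonzero, the ratio statements follow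
(`tendsto_expectedShortfall_div_quantile`, `tendsto_expectileTCE_div_expectile` and their endpoint
versions).

To compare `e` with `q`, divide the expectile equation by `G(e)`: `α/G(e)` tends to `β` if the
endpoint is infinite and to `0` if it is finite. Inverting `G` gives `e ~ (η-1)^(-1/η) q` for
Fréchet and `x - q = o(x - e)` for Weibull; in the unbounded Gumbel case a separate lower estimate
gives `e ~ q`. Such relations pass to averages over `(0, α)`, hence the claims on `es_α`, and
domination near `0` gives its finiteness.

The passage from sequences `c_n, d_n` to a limit in a continuous variable is made once for all three
laws (`exists_tailLimit`). Only the size of the scale function relative to `t` or `x - t` is found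
case by case. -/

namespace ExpectileRisk

/-! ### Domains of attraction as rescaled limits of the tail. -/

/-- The filter of points at which `G` tends to zero through positive values; for the tail of a
distribution without an atom at its right endpoint, `t` tends to the endpoint from the left. -/
def tailFilter (G : ℝ → ℝ) : Filter ℝ := comap G (𝓝[>] 0)

instance (G : ℝ → ℝ) : (tailFilter G).IsCountablyGenerated := by
  unfold tailFilter; infer_instance

theorem eventually_tailFilter {G : ℝ → ℝ} {p : ℝ → Prop} :
    (∀ᶠ t in tailFilter G, p t) ↔ ∃ ε > 0, ∀ t, 0 < G t → G t < ε → p t := by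
  rw [tailFilter, ((nhdsGT_basis (0 : ℝ)).comap G).eventually_iff]
  simp [Set.mem_Ioo, and_imp]

theorem tendsto_tailFilter {ι : Type*} {l : Filter ι} {G : ℝ → ℝ} {f : ι → ℝ} :
    Tendsto f l (tailFilter G) ↔ Tendsto (fun i => G (f i)) l (𝓝[>] 0) := by
  rw [tailFilter, tendsto_comap_iff]; rfl

theorem tendsto_self_tailFilter {G : ℝ → ℝ} : Tendsto G (tailFilter G) (𝓝[>] 0) :=
  tendsto_comap

theorem eventually_pos_tailFilter {G : ℝ → ℝ} : ∀ᶠ t in tailFilter G, 0 < G t :=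
  eventually_tailFilter.2 ⟨1, one_pos, fun _ h _ => h⟩

/-- Taking logarithms gives `n log u_n → log h`, and `u - 1` lies between `log u` and `u log u`,
while `u_n → 1`. -/
theorem tendsto_mul_one_sub_of_pow {u : ℕ → ℝ} {h : ℝ} (hh : 0 < h)
    (hu0 : ∀ n, 0 ≤ u n) (hu : Tendsto (fun n => u n ^ n) atTop (𝓝 h)) :
    Tendsto (fun n : ℕ => (n : ℝ) * (1 - u n)) atTop (𝓝 (-Real.log h)) := by
  have hlog : Tendsto (fun n : ℕ => (n : ℝ) * Real.log (u n)) atTop (𝓝 (Real.log h)) := by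
    have := hu.log hh.ne'
    simpa [Real.log_pow] using this
  have hpos : ∀ᶠ n : ℕ in atTop, 0 < u n := by
    filter_upwards [hu.eventually (lt_mem_nhds hh), eventually_ge_atTop 1] with n hn h1
    rcases (hu0 n).lt_or_eq with h | h
    · exact h
    · rw [← h, zero_pow (by omega)] at hn
      exact absurd hn (lt_irrefl _)
  have hlog0 : Tendsto (fun n : ℕ => Real.log (u n)) atTop (𝓝 0) := by
    have := hlog.mul (tendsto_inv_atTop_nhds_zero_nat (𝕜 := ℝ))
    rw [mul_zero] at this
    refine this.congr' ?_
    filter_upwards [eventually_ge_atTop 1] with n hn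
    have : (n : ℝ) ≠ 0 := by positivity
    field_simp
  have hu1 : Tendsto u atTop (𝓝 1) := by
    have := (Real.continuous_exp.tendsto 0).comp hlog0
    rw [Real.exp_zero] at this
    refine this.congr' ?_
    filter_upwards [hpos] with n hn
    exact Real.exp_log hn
  have hlow : Tendsto (fun n : ℕ => -(u n * ((n : ℝ) * Real.log (u n)))) atTop
      (𝓝 (-Real.log h)) := by
    simpa using (hu1.mul hlog).neg
  refine tendsto_of_tendsto_of_tendsto_of_le_of_le' hlow hlog.neg ?_ ?_
  · filter_upwards [hpos] with n hn
    have h1 := Real.one_sub_inv_le_log_of_pos hn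
    have h2 : u n - 1 ≤ u n * Real.log (u n) := by
      have := mul_le_mul_of_nonneg_left h1 hn.le
      rwa [mul_sub, mul_one, mul_inv_cancel₀ hn.ne'] at this
    have := mul_le_mul_of_nonneg_left h2 (Nat.cast_nonneg (α := ℝ) n)
    linarith
  · filter_upwards [hpos] with n hn
    have h1 := Real.log_le_sub_one_of_pos hn
    have := mul_le_mul_of_nonneg_left h1 (Nat.cast_nonneg (α := ℝ) n)
    linarith

/-- The tail `G`, rescaled by `a` around a point `t` near the endpoint, tends to `V` on `S`. -/
structure TailLimit (G a : ℝ → ℝ) (S : Set ℝ) (V : ℝ → ℝ) : Prop where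
  anti : Antitone G
  scale_pos : ∀ t, 0 < a t
  isOpen : IsOpen S
  zero_mem : 0 ∈ S
  continuousOn : ContinuousOn V S
  strictAnti : StrictAntiOn V S
  map_zero : V 0 = 1
  pos : ∀ z ∈ S, 0 < V z
  neBot : (tailFilter G).NeBot
  tendsto : ∀ z ∈ S, Tendsto (fun t => G (t + a t * z) / G t) (tailFilter G) (𝓝 (V z))

/-- Choose the index by the tail itself: `N(t) = ⌊1/G(t)⌋`, so that `N G(t) → 1 = V 0`. Strict
monotonicity of `V` at `0` then traps `t` between `c_N y + d_N` for small `y < 0` and small `y > 0`,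
so `t` may replace `d_N`; monotonicity of `G` and continuity of `V` absorb the error. -/
theorem exists_tailLimit {G : ℝ → ℝ} (hG : Antitone G) {c d : ℕ → ℝ} (hc : ∀ n, 0 < c n)
    {S : Set ℝ} {V : ℝ → ℝ} (hS : IsOpen S) (h0 : 0 ∈ S) (hV : ContinuousOn V S)
    (hVa : StrictAntiOn V S) (hV0 : V 0 = 1) (hVp : ∀ z ∈ S, 0 < V z)
    (h : ∀ z ∈ S, Tendsto (fun n : ℕ => (n : ℝ) * G (c n * z + d n)) atTop (𝓝 (V z))) :
    ∃ a, TailLimit G a S V := by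
  have hfl : Tendsto (fun t => 1 / G t) (tailFilter G) atTop := by
    simp only [one_div]
    exact tendsto_self_tailFilter.inv_tendsto_nhdsGT_zero
  have hN : Tendsto (fun t => ⌊1 / G t⌋₊) (tailFilter G) atTop :=
    tendsto_nat_floor_atTop.comp hfl
  have hNG : Tendsto (fun t => (⌊1 / G t⌋₊ : ℝ) * G t) (tailFilter G) (𝓝 1) := by
    have := (tendsto_nat_floor_div_atTop (R := ℝ)).comp hfl
    refine this.congr' ?_
    filter_upwards [eventually_pos_tailFilter] with t ht
    simp [div_eq_mul_inv]
  set N : ℝ → ℕ := fun t => ⌊1 / G t⌋₊ with hNdef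
  refine ⟨fun t => c (N t), hG, fun t => hc _, hS, h0, hV, hVa, hV0, hVp, ?_, ?_⟩
  · have h1 := h 0 h0
    rw [hV0] at h1
    have hpos : ∀ᶠ n : ℕ in atTop, 0 < (n : ℝ) * G (c n * 0 + d n) :=
      h1.eventually (lt_mem_nhds one_pos)
    have : Tendsto (fun n : ℕ => c n * 0 + d n) atTop (tailFilter G) := by
      rw [tendsto_tailFilter, tendsto_nhdsWithin_iff]
      constructor
      · have := h1.mul (tendsto_inv_atTop_nhds_zero_nat (𝕜 := ℝ))
        rw [mul_zero] at this
        refine this.congr' ?_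
        filter_upwards [eventually_ge_atTop 1] with n hn
        have : (n : ℝ) ≠ 0 := by positivity
        field_simp
      · filter_upwards [hpos] with n hn
        exact pos_of_mul_pos_right hn (Nat.cast_nonneg n)
    exact this.neBot
  · have hlow : ∀ y < 0, ∀ᶠ t in tailFilter G, c (N t) * y + d (N t) < t := by
      intro y hy
      obtain ⟨y1, hy1, hy1S⟩ : ∃ y1 ∈ Set.Ioo y 0, y1 ∈ S := by
        have : S ∈ 𝓝[<] (0 : ℝ) := mem_nhdsWithin_of_mem_nhds (hS.mem_nhds h0)
        exact (Filter.nonempty_of_mem (inter_mem (Ioo_mem_nhdsLT hy) this))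
      have hV1 : 1 < V y1 := hV0 ▸ hVa hy1S h0 hy1.2
      filter_upwards [hNG.eventually_lt ((h y1 hy1S).comp hN) hV1] with t ht
      simp only [Function.comp] at ht
      have : G t < G (c (N t) * y1 + d (N t)) := lt_of_mul_lt_mul_left ht (Nat.cast_nonneg _)
      have := hG.reflect_lt this
      nlinarith [hc (N t), hy1.1]
    have hup : ∀ y > 0, ∀ᶠ t in tailFilter G, t < c (N t) * y + d (N t) := by
      intro y hy
      obtain ⟨y1, hy1, hy1S⟩ : ∃ y1 ∈ Set.Ioo 0 y, y1 ∈ S := by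
        have : S ∈ 𝓝[>] (0 : ℝ) := mem_nhdsWithin_of_mem_nhds (hS.mem_nhds h0)
        exact (Filter.nonempty_of_mem (inter_mem (Ioo_mem_nhdsGT hy) this))
      have hV1 : V y1 < 1 := hV0 ▸ hVa h0 hy1S hy1.1
      filter_upwards [((h y1 hy1S).comp hN).eventually_lt hNG hV1] with t ht
      simp only [Function.comp] at ht
      have : G (c (N t) * y1 + d (N t)) < G t := lt_of_mul_lt_mul_left ht (Nat.cast_nonneg _)
      have := hG.reflect_lt this
      nlinarith [hc (N t), hy1.2]
    intro z hz
    have hmul : Tendsto (fun t => (N t : ℝ) * G (t + c (N t) * z)) (tailFilter G) (𝓝 (V z)) := by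
      have hVz : ContinuousAt V z := hV.continuousAt (hS.mem_nhds hz)
      refine tendsto_order.2 ⟨fun b hb => ?_, fun b hb => ?_⟩
      · have hev : ∀ᶠ y in 𝓝[>] z, b < V y ∧ y ∈ S :=
          mem_nhdsWithin_of_mem_nhds
            ((hVz.eventually (lt_mem_nhds hb)).and (hS.mem_nhds hz))
        obtain ⟨y, ⟨hby, hyS⟩, hzy⟩ := (hev.and self_mem_nhdsWithin).exists
        have hzy : z < y := hzy
        filter_upwards [hup (y - z) (by linarith),
          ((h y hyS).comp hN).eventually (lt_mem_nhds hby)] with t ht hb'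
        refine lt_of_lt_of_le hb' (mul_le_mul_of_nonneg_left (hG ?_) (Nat.cast_nonneg _))
        nlinarith
      · have hev : ∀ᶠ y in 𝓝[<] z, V y < b ∧ y ∈ S :=
          mem_nhdsWithin_of_mem_nhds
            ((hVz.eventually (gt_mem_nhds hb)).and (hS.mem_nhds hz))
        obtain ⟨y, ⟨hby, hyS⟩, hzy⟩ := (hev.and self_mem_nhdsWithin).exists
        have hzy : y < z := hzy
        filter_upwards [hlow (y - z) (by linarith),
          ((h y hyS).comp hN).eventually (gt_mem_nhds hby)] with t ht hb'
        refine lt_of_le_of_lt (mul_le_mul_of_nonneg_left (hG ?_) (Nat.cast_nonneg _)) hb'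
        nlinarith
    have := hmul.div hNG one_ne_zero
    rw [div_one] at this
    refine this.congr' ?_
    filter_upwards [hN.eventually (eventually_ge_atTop 1)] with t ht
    have : (N t : ℝ) ≠ 0 := by
      have : 1 ≤ N t := ht
      positivity
    exact mul_div_mul_left _ _ this

namespace TailLimit

variable {G a : ℝ → ℝ} {S : Set ℝ} {V : ℝ → ℝ}

/-- A monotone function converging pointwise to a continuous limit does so along moving arguments as
well: squeeze `b t / a t` between fixed points close to `z`. -/
theorem tendsto_add (h : TailLimit G a S V) {b : ℝ → ℝ} {z : ℝ} (hz : z ∈ S)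
    (hb : Tendsto (fun t => b t / a t) (tailFilter G) (𝓝 z)) :
    Tendsto (fun t => G (t + b t) / G t) (tailFilter G) (𝓝 (V z)) := by
  have hVz : ContinuousAt V z := h.continuousOn.continuousAt (h.isOpen.mem_nhds hz)
  refine tendsto_order.2 ⟨fun k hk => ?_, fun k hk => ?_⟩
  · have hev : ∀ᶠ y in 𝓝[>] z, k < V y ∧ y ∈ S :=
      mem_nhdsWithin_of_mem_nhds
        ((hVz.eventually (lt_mem_nhds hk)).and (h.isOpen.mem_nhds hz))
    obtain ⟨y, ⟨hby, hyS⟩, hzy⟩ := (hev.and self_mem_nhdsWithin).exists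
    filter_upwards [hb.eventually (gt_mem_nhds (show z < y from hzy)),
      (h.tendsto y hyS).eventually (lt_mem_nhds hby), eventually_pos_tailFilter] with t h1 h2 h3
    refine h2.trans_le (div_le_div_of_nonneg_right (h.anti ?_) h3.le)
    rw [div_lt_iff₀ (h.scale_pos t)] at h1
    linarith
  · have hev : ∀ᶠ y in 𝓝[<] z, V y < k ∧ y ∈ S :=
      mem_nhdsWithin_of_mem_nhds
        ((hVz.eventually (gt_mem_nhds hk)).and (h.isOpen.mem_nhds hz))
    obtain ⟨y, ⟨hby, hyS⟩, hzy⟩ := (hev.and self_mem_nhdsWithin).exists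
    filter_upwards [hb.eventually (lt_mem_nhds (show y < z from hzy)),
      (h.tendsto y hyS).eventually (gt_mem_nhds hby), eventually_pos_tailFilter] with t h1 h2 h3
    refine (div_le_div_of_nonneg_right (h.anti ?_) h3.le).trans_lt h2
    rw [lt_div_iff₀ (h.scale_pos t)] at h1
    linarith

theorem tendsto_shift (h : TailLimit G a S V) {z : ℝ} (hz : z ∈ S) :
    Tendsto (fun t => t + a t * z) (tailFilter G) (tailFilter G) := by
  rw [tendsto_tailFilter, tendsto_nhdsWithin_iff]
  have h0 := h.tendsto z hz
  constructor
  · have := h0.mul (tendsto_self_tailFilter.mono_right nhdsWithin_le_nhds)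
    rw [mul_zero] at this
    refine this.congr' ?_
    filter_upwards [eventually_pos_tailFilter] with t ht
    exact div_mul_cancel₀ _ ht.ne'
  · filter_upwards [eventually_pos_tailFilter,
      h0.eventually (lt_mem_nhds (h.pos z hz))] with t ht h1
    exact (div_pos_iff_of_pos_right ht).1 h1

theorem tendsto_shift_shift (h : TailLimit G a S V) {z w : ℝ} (hz : z ∈ S) (hw : w ∈ S) :
    Tendsto (fun t => G (t + a t * z + a (t + a t * z) * w) / G t) (tailFilter G)
      (𝓝 (V w * V z)) := by
  refine (((h.tendsto w hw).comp (h.tendsto_shift hz)).mul (h.tendsto z hz)).congr' ?_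
  filter_upwards [(h.tendsto_shift hz).eventually eventually_pos_tailFilter] with t ht
  simp only [Function.comp]
  exact div_mul_div_cancel₀ ht.ne'

/-- Two successive shifts multiply limits of `V`, a single one evaluates `V` once. Since `G`
decreases, comparing these limits compares the end points, hence the scales at `t` and at the
shifted point. This replaces a convergence-of-types argument. -/
theorem scale_shift_lt (h : TailLimit G a S V) {z w v : ℝ} (hz : z ∈ S) (hw : w ∈ S)
    (hv : z + v ∈ S) (hlt : V (z + v) < V w * V z) :
    ∀ᶠ t in tailFilter G, a (t + a t * z) * w < a t * v := by
  filter_upwards [(h.tendsto _ hv).eventually_lt (h.tendsto_shift_shift hz hw) hlt,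
    eventually_pos_tailFilter] with t h1 ht
  have := h.anti.reflect_lt ((div_lt_div_iff_of_pos_right ht).1 h1)
  linarith

theorem lt_scale_shift (h : TailLimit G a S V) {z w v : ℝ} (hz : z ∈ S) (hw : w ∈ S)
    (hv : z + v ∈ S) (hlt : V w * V z < V (z + v)) :
    ∀ᶠ t in tailFilter G, a t * v < a (t + a t * z) * w := by
  filter_upwards [(h.tendsto_shift_shift hz hw).eventually_lt (h.tendsto _ hv) hlt,
    eventually_pos_tailFilter] with t h1 ht
  have := h.anti.reflect_lt ((div_lt_div_iff_of_pos_right ht).1 h1)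
  linarith

end TailLimit
end ExpectileRisk
-- Size of the scale function; regular and rapid variation.
namespace ExpectileRisk

theorem tailFilter_eq_atTop {G : ℝ → ℝ} (hG : Antitone G) (hpos : ∀ t, 0 < G t)
    (h0 : Tendsto G atTop (𝓝 0)) : tailFilter G = atTop := by
  refine le_antisymm (tendsto_id'.1 (tendsto_atTop.2 fun T => eventually_tailFilter.2
    ⟨G T, hpos T, fun t _ ht => (hG.reflect_lt ht).le⟩)) ?_
  have : Tendsto id atTop (tailFilter G) := by
    rw [tendsto_tailFilter, tendsto_nhdsWithin_iff]
    exact ⟨h0, Eventually.of_forall fun t => hpos t⟩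
  exact this

namespace TailLimit

variable {G a : ℝ → ℝ}

section Frechet

variable {η : ℝ} (hη : 0 < η) (h : TailLimit G a (Set.Ioi (-1)) fun z => (1 + z) ^ (-η))
include hη h

/-- Steps `u ↦ u + a u` stay where `G` is positive and enlarge the scale by at least `3/2` each time
(asymptotically by `2`), so they pass every real number. -/
theorem frechet_pos (hG0 : ∀ t, 0 ≤ G t) (t : ℝ) : 0 < G t := by
  by_contra hneg
  have ht0 : G t = 0 := le_antisymm (not_lt.1 hneg) (hG0 t)
  have hgrow : ∀ᶠ t in tailFilter G, a t * (3 / 2) < a (t + a t * 1) * 1 := by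
    refine h.lt_scale_shift (by norm_num) (by norm_num) (by norm_num) ?_
    rw [← Real.mul_rpow (by norm_num) (by norm_num)]
    exact Real.rpow_lt_rpow_of_neg (by norm_num) (by norm_num) (by linarith)
  have hev := hgrow.and
    ((h.tendsto_shift (z := 1) (by norm_num)).eventually eventually_pos_tailFilter)
  obtain ⟨ε, hε, H⟩ := eventually_tailFilter.1 hev
  have := h.neBot
  obtain ⟨s, hs0, hsε⟩ : ∃ s, 0 < G s ∧ G s < ε := by
    have : ∀ᶠ s in tailFilter G, 0 < G s ∧ G s < ε :=
      eventually_tailFilter.2 ⟨ε, hε, fun t h1 h2 => ⟨h1, h2⟩⟩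
    exact this.exists
  have iter : ∀ k : ℕ, ∃ u, s ≤ u ∧ 0 < G u ∧ G u < ε ∧ a s * (3 / 2) ^ k ≤ a u := by
    intro k
    induction k with
    | zero => exact ⟨s, le_rfl, hs0, hsε, by simp⟩
    | succ k ih =>
      obtain ⟨u, h1, h2, h3, h4⟩ := ih
      obtain ⟨h5, h6⟩ := H u h2 h3
      have h7 : u ≤ u + a u * 1 := by linarith [h.scale_pos u]
      refine ⟨u + a u * 1, h1.trans h7, h6, (h.anti h7).trans_lt h3, ?_⟩
      rw [pow_succ]
      linarith
  obtain ⟨k, hk⟩ := pow_unbounded_of_one_lt ((t - s) / a s) (show (1 : ℝ) < 3 / 2 by norm_num)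
  obtain ⟨u, h1, h2, h3, h4⟩ := iter k
  obtain ⟨-, h6⟩ := H u h2 h3
  rw [← ht0] at h6
  have := h.anti.reflect_lt h6
  rw [div_lt_iff₀ (h.scale_pos s)] at hk
  linarith

/-- Walk back from `t` in steps of `z` scales. Each step contracts the scale to at most `1 - z + ε`
of itself, so the total length is bounded by a geometric series of sum `z/(z - ε) = 1 + δ` in units
of `a t`. Each step more than doubles `G`, so the value `G T` is reached after finitely many; the
induction is on this number. -/
theorem frechet_le {δ : ℝ} (hδ : 0 < δ) :
    ∃ T, ∀ᶠ t in tailFilter G, t - T ≤ (1 + δ) * a t := by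
  obtain ⟨z, hz0, hz1, hz2⟩ : ∃ z : ℝ, 0 < z ∧ z < 1 ∧ 2 < (1 + -z) ^ (-η) := by
    have : Tendsto (fun y : ℝ => y ^ (-η)) (𝓝[>] 0) atTop := tendsto_rpow_neg_nhdsGT_zero (by linarith)
    have := ((this.eventually (eventually_gt_atTop 2)).and
      (Ioo_mem_nhdsGT (show (0 : ℝ) < 1 by norm_num))).exists
    obtain ⟨y, hy, hy0, hy1⟩ := this
    exact ⟨1 - y, by linarith, by linarith, by simpa using hy⟩
  -- the scale contracts by almost `1 - z` when stepping back by `z` units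
  set ε := δ * z / (1 + δ) with hε
  have hε0 : 0 < ε := by positivity
  have hεz : (1 + δ) * ε = δ * z := by rw [hε]; field_simp
  have hεz' : ε < z := by nlinarith
  have hmem : -z ∈ Set.Ioi (-1 : ℝ) := by simpa using hz1
  have hstep : ∀ᶠ t in tailFilter G, a (t + a t * -z) * 1 < a t * (1 - z + ε) := by
    have hw : (1 : ℝ) ∈ Set.Ioi (-1 : ℝ) := by norm_num
    have hv : -z + (1 - z + ε) ∈ Set.Ioi (-1 : ℝ) := by
      simp only [Set.mem_Ioi]; linarith
    refine h.scale_shift_lt hmem hw hv ?_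
    rw [← Real.mul_rpow (by norm_num) (by linarith)]
    exact Real.rpow_lt_rpow_of_neg (by linarith) (by linarith) (by linarith)
  obtain ⟨ε0, hε0', H⟩ := eventually_tailFilter.1
    (hstep.and (((h.tendsto _ hmem).eventually (lt_mem_nhds hz2)).and
      ((h.tendsto_shift hmem).eventually eventually_pos_tailFilter)))
  have := h.neBot
  obtain ⟨T, hT0, hTε⟩ : ∃ s, 0 < G s ∧ G s < ε0 := by
    have : ∀ᶠ s in tailFilter G, 0 < G s ∧ G s < ε0 :=
      eventually_tailFilter.2 ⟨ε0, hε0', fun t h1 h2 => ⟨h1, h2⟩⟩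
    exact this.exists
  refine ⟨T, eventually_tailFilter.2 ⟨ε0, hε0', ?_⟩⟩
  have iter : ∀ k : ℕ, ∀ t, 0 < G t → G t < ε0 → G T ≤ 2 ^ k * G t →
      t - T ≤ (1 + δ) * a t := by
    intro k
    induction k with
    | zero =>
      intro t h1 h2 h3
      obtain ⟨-, h5, h6⟩ := H t h1 h2
      rw [lt_div_iff₀ h1] at h5
      have : G T < G (t + a t * -z) := by linarith
      have := h.anti.reflect_lt this
      nlinarith [h.scale_pos t, mul_pos hδ (h.scale_pos t)]
    | succ k ih =>
      intro t h1 h2 h3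
      obtain ⟨h4, h5, h6⟩ := H t h1 h2
      rw [lt_div_iff₀ h1] at h5
      rcases le_or_gt (t + a t * -z) T with hle | hgt
      · nlinarith [h.scale_pos t, mul_pos hδ (h.scale_pos t)]
      · have h7 := (h.anti hgt.le).trans_lt hTε
        have h8 := ih (t + a t * -z) h6 h7 (by
          rw [pow_succ] at h3
          have : (0 : ℝ) < 2 ^ k := by positivity
          nlinarith)
        have h9 : (1 + δ) * a (t + a t * -z) ≤ (1 + δ) * (a t * (1 - z + ε)) :=
          mul_le_mul_of_nonneg_left (by linarith) (by linarith)
        have h10 : (1 + δ) * (a t * (1 - z + ε)) = (1 + δ) * a t - z * a t := by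
          linear_combination a t * hεz
        linarith
  intro t h1 h2
  obtain ⟨k, hk⟩ := pow_unbounded_of_one_lt (G T / G t) (show (1 : ℝ) < 2 by norm_num)
  exact iter k t h1 h2 ((div_lt_iff₀ h1).1 hk).le

theorem frechet_div (hl : tailFilter G = atTop) :
    Tendsto (fun t => t / a t) (tailFilter G) (𝓝 1) := by
  refine tendsto_order.2 ⟨fun b hb => ?_, fun b hb => ?_⟩
  · obtain ⟨y, hy1, hy2⟩ := exists_between (max_lt hb (show (-1 : ℝ) < 1 by norm_num))
    have hmem : -y ∈ Set.Ioi (-1 : ℝ) := by simpa using hy2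
    have := (h.tendsto_shift hmem)
    nth_rewrite 2 [hl] at this
    filter_upwards [this.eventually (eventually_ge_atTop 0)] with t ht
    rw [lt_div_iff₀ (h.scale_pos t)]
    nlinarith [h.scale_pos t, le_max_left b (-1)]
  · obtain ⟨T, hT⟩ := h.frechet_le hη (δ := (b - 1) / 3) (by linarith)
    -- For large `t` the constant `T` costs only a small fraction of `t`; it uses the slack between
    -- `(b-1)/2` and `b - 1`, while `δ` stays below `(b-1)/2`.
    have h2 : ∀ᶠ t in tailFilter G, T ≤ (1 - (1 + (b - 1) / 2) / b) * t ∧ 0 < t := by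
      rw [hl]
      have : 0 < 1 - (1 + (b - 1) / 2) / b := by
        rw [sub_pos, div_lt_one (by linarith)]; linarith
      exact ((tendsto_id.const_mul_atTop this).eventually (eventually_ge_atTop T)).and
        (eventually_gt_atTop 0)
    filter_upwards [hT, h2] with t h3 h4
    rw [div_lt_iff₀ (h.scale_pos t)]
    have h5 : (1 + (b - 1) / 2) / b * t ≤ (1 + (b - 1) / 3) * a t := by linarith [h4.1]
    have h6 : (1 + (b - 1) / 2) * t ≤ (1 + (b - 1) / 3) * (b * a t) := by
      have := mul_le_mul_of_nonneg_left h5 (show 0 ≤ b by linarith)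
      have e : b * ((1 + (b - 1) / 2) / b * t) = (1 + (b - 1) / 2) * t := by
        field_simp
      linarith
    have h7 : (1 + (b - 1) / 3) * t < (1 + (b - 1) / 2) * t :=
      mul_lt_mul_of_pos_right (by linarith) h4.2
    exact lt_of_mul_lt_mul_left (h7.trans_le h6) (by linarith)

theorem frechet_regular (hl : tailFilter G = atTop) {c : ℝ} (hc : 0 < c) :
    Tendsto (fun t => G (c * t) / G t) (tailFilter G) (𝓝 (c ^ (-η))) := by
  have hb : Tendsto (fun t => (c - 1) * t / a t) (tailFilter G) (𝓝 (c - 1)) := by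
    simpa [mul_div_assoc] using (h.frechet_div hη hl).const_mul (c - 1)
  have := h.tendsto_add (z := c - 1) (by simpa using hc) hb
  simpa [sub_mul] using this

end Frechet

section Weibull

variable {η : ℝ} (hη : 0 < η) (h : TailLimit G a (Set.Iio 1) fun z => (1 - z) ^ η)
include hη h

/-- The same geometric series, walking forward by half a scale at a time; each step shrinks the tail
by a factor below `θ < 1` until `s` is passed. The bound is uniform in `s`, so it also proves that
the endpoint is finite. -/
theorem weibull_le {δ : ℝ} (hδ : 0 < δ) :
    ∀ᶠ t in tailFilter G, ∀ s, 0 < G s → s - t ≤ (1 + δ) * a t := by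
  obtain ⟨z, hz⟩ : ∃ z : ℝ, z = 1 / 2 := ⟨_, rfl⟩
  have hz0 : 0 < z := by rw [hz]; norm_num
  -- Any number strictly between `V (1/2) = (1/2)^η` and `1` would serve.
  set θ : ℝ := (1 / 2 : ℝ) ^ (η / 2) with hθ
  have hθ0 : 0 < θ := by positivity
  have hθ1 : θ < 1 := Real.rpow_lt_one (by norm_num) (by norm_num) (by linarith)
  -- The cap `1/4`, like the comparison shift `w = 1/2` below, keeps all arguments of `V` under `1`.
  set ε := min (δ * z / (1 + δ)) (1 / 4) with hε
  have hε0 : 0 < ε := lt_min (by positivity) (by norm_num)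
  have hεz : (1 + δ) * ε ≤ δ * z := by
    rw [← le_div_iff₀' (by linarith)]
    exact min_le_left _ _
  have hε4 : ε ≤ 1 / 4 := min_le_right _ _
  have hmem : z ∈ Set.Iio (1 : ℝ) := by simp only [Set.mem_Iio, hz]; norm_num
  have hstep : ∀ᶠ t in tailFilter G, a (t + a t * z) * (1 / 2) < a t * ((1 - z + ε) * (1 / 2)) := by
    have hw : (1 / 2 : ℝ) ∈ Set.Iio (1 : ℝ) := by simp only [Set.mem_Iio]; norm_num
    have hv : z + ((1 - z + ε) * (1 / 2)) ∈ Set.Iio (1 : ℝ) := by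
      simp only [Set.mem_Iio, hz]; linarith
    refine h.scale_shift_lt hmem hw hv ?_
    rw [← Real.mul_rpow (by norm_num) (by norm_num [hz])]
    refine Real.rpow_lt_rpow ?_ ?_ hη
    · simp only [hz]; linarith
    · simp only [hz]; linarith
  have hV : (1 - z) ^ η < θ := by
    have : (1 - z : ℝ) = 1 / 2 := by norm_num [hz]
    rw [this, hθ]
    exact Real.rpow_lt_rpow_of_exponent_gt (by norm_num) (by norm_num) (by linarith)
  obtain ⟨ε0, hε0', H⟩ := eventually_tailFilter.1
    (hstep.and ((h.tendsto _ hmem).eventually (gt_mem_nhds hV)))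
  refine eventually_tailFilter.2 ⟨ε0, hε0', ?_⟩
  intro t ht0 htε s hs
  have iter : ∀ k : ℕ, ∀ t, 0 < G t → G t < ε0 → θ ^ k * G t ≤ G s →
      s - t ≤ (1 + δ) * a t := by
    intro k
    induction k with
    | zero =>
      intro t h1 h2 h3
      obtain ⟨-, h5⟩ := H t h1 h2
      rw [div_lt_iff₀ h1] at h5
      have : G (t + a t * z) < G s := by
        rw [pow_zero, one_mul] at h3
        nlinarith
      have := h.anti.reflect_lt this
      simp only [hz] at this
      nlinarith [h.scale_pos t, mul_pos hδ (h.scale_pos t)]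
    | succ k ih =>
      intro t h1 h2 h3
      obtain ⟨h4, h5⟩ := H t h1 h2
      rw [div_lt_iff₀ h1] at h5
      rcases le_or_gt s (t + a t * z) with hle | hgt
      · simp only [hz] at hle
        nlinarith [h.scale_pos t, mul_pos hδ (h.scale_pos t)]
      · have h6 : 0 < G (t + a t * z) := hs.trans_le (h.anti hgt.le)
        have h8 := ih (t + a t * z) h6 (by nlinarith) (by
          rw [pow_succ] at h3
          have : (0 : ℝ) < θ ^ k := by positivity
          nlinarith)
        have h9 : (1 + δ) * a (t + a t * z) ≤ (1 + δ) * (a t * (1 - z + ε)) :=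
          mul_le_mul_of_nonneg_left (by linarith) (by linarith)
        have h10 : (1 + δ) * (a t * (1 - z + ε)) ≤ (1 + δ) * a t - z * a t := by
          nlinarith [mul_le_mul_of_nonneg_left hεz (h.scale_pos t).le]
        linarith
  obtain ⟨k, hk⟩ := exists_pow_lt_of_lt_one (div_pos hs ht0) hθ1
  exact iter k t ht0 htε ((lt_div_iff₀ ht0).1 hk).le

/-- Shifts by `b < 1` scales remain below the endpoint, which bounds the ratio from below;
`weibull_le` with `s` close to `x` bounds it from above. -/
theorem weibull_div {x : ℝ} (hx : ∀ t, 0 < G t ↔ t < x) :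
    Tendsto (fun t => (x - t) / a t) (tailFilter G) (𝓝 1) := by
  refine tendsto_order.2 ⟨fun b hb => ?_, fun b hb => ?_⟩
  · filter_upwards [(h.tendsto_shift (z := b) hb).eventually eventually_pos_tailFilter] with t ht
    rw [lt_div_iff₀ (h.scale_pos t)]
    rw [hx] at ht
    linarith
  · filter_upwards [h.weibull_le hη (δ := (b - 1) / 2) (by linarith)] with t ht
    rw [div_lt_iff₀ (h.scale_pos t)]
    have : x ≤ t + (1 + (b - 1) / 2) * a t :=
      le_of_forall_lt fun s hs => by
        have h2 := ht ((s + x) / 2) ((hx _).2 (by linarith))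
        linarith
    nlinarith [h.scale_pos t]

theorem weibull_regular {x : ℝ} (hx : ∀ t, 0 < G t ↔ t < x) {c : ℝ} (hc : 0 < c) :
    Tendsto (fun t => G (x - c * (x - t)) / G t) (tailFilter G) (𝓝 (c ^ η)) := by
  have hb : Tendsto (fun t => (1 - c) * (x - t) / a t) (tailFilter G) (𝓝 (1 - c)) := by
    simpa [mul_div_assoc] using (h.weibull_div hη hx).const_mul (1 - c)
  have := h.tendsto_add (z := 1 - c) (by simpa using hc) hb
  simp only [sub_sub_cancel] at this
  refine this.congr fun t => ?_
  congr 2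
  ring

end Weibull

section Gumbel

variable (h : TailLimit G a Set.univ fun z => Real.exp (-z))
include h

theorem gumbel_add {b : ℝ → ℝ} (hG0 : ∀ t, 0 ≤ G t)
    (hb : Tendsto (fun t => b t / a t) (tailFilter G) atTop) :
    Tendsto (fun t => G (t + b t) / G t) (tailFilter G) (𝓝 0) := by
  refine tendsto_order.2 ⟨fun k hk => Eventually.of_forall fun t =>
    hk.trans_le (div_nonneg (hG0 _) (hG0 _)), fun k hk => ?_⟩
  obtain ⟨z, hz⟩ := ((Real.tendsto_exp_neg_atTop_nhds_zero).eventually (gt_mem_nhds hk)).exists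
  filter_upwards [hb.eventually (eventually_ge_atTop z),
    (h.tendsto z trivial).eventually (gt_mem_nhds hz), eventually_pos_tailFilter] with t h1 h2 h3
  refine (div_le_div_of_nonneg_right (h.anti ?_) h3.le).trans_lt h2
  rw [le_div_iff₀ (h.scale_pos t)] at h1
  linarith

/-- Here all real shifts are allowed, and `t - b a t` is eventually nonnegative for every `b`. So
the scale is negligible against `t`, and a multiplicative shift is infinitely many scales long. -/
theorem gumbel_rapid (hG0 : ∀ t, 0 ≤ G t) (hl : tailFilter G = atTop) {c : ℝ} (hc : 1 < c) :
    Tendsto (fun t => G (c * t) / G t) (tailFilter G) (𝓝 0) := by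
  have hdiv : Tendsto (fun t => t / a t) (tailFilter G) atTop := by
    refine tendsto_atTop.2 fun b => ?_
    have := h.tendsto_shift (z := -b) trivial
    nth_rewrite 2 [hl] at this
    filter_upwards [this.eventually (eventually_ge_atTop 0)] with t ht
    rw [le_div_iff₀ (h.scale_pos t)]
    linarith
  have hb : Tendsto (fun t => (c - 1) * t / a t) (tailFilter G) atTop := by
    simpa [mul_div_assoc] using hdiv.const_mul_atTop (sub_pos.2 hc)
  simpa [sub_mul] using h.gumbel_add hG0 hb

theorem gumbel_rapid_endpoint (hG0 : ∀ t, 0 ≤ G t) {x : ℝ} (hx : ∀ t, 0 < G t ↔ t < x)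
    {c : ℝ} (hc : c < 1) :
    Tendsto (fun t => G (x - c * (x - t)) / G t) (tailFilter G) (𝓝 0) := by
  have hdiv : Tendsto (fun t => (x - t) / a t) (tailFilter G) atTop := by
    refine tendsto_atTop.2 fun b => ?_
    filter_upwards [(h.tendsto_shift (z := b) trivial).eventually
      eventually_pos_tailFilter] with t ht
    rw [le_div_iff₀ (h.scale_pos t)]
    rw [hx] at ht
    linarith
  have hb : Tendsto (fun t => (1 - c) * (x - t) / a t) (tailFilter G) atTop := by
    simpa [mul_div_assoc] using hdiv.const_mul_atTop (sub_pos.2 hc)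
  refine (h.gumbel_add hG0 hb).congr fun t => ?_
  congr 2
  ring

end Gumbel

end TailLimit
end ExpectileRisk
-- Karamata's theorem for the integrated tail.
namespace ExpectileRisk

/-- Karamata's theorem for a decreasing function, with the limit ratio `φ` allowed to vanish. -/
theorem tendsto_setIntegral_Ioi_div {G φ : ℝ → ℝ} (hG : Antitone G) (hpos : ∀ t, 0 < G t)
    {p : ℝ} (hp : 1 < p)
    (hφ : ∀ s, 1 < s → Tendsto (fun t => G (s * t) / G t) atTop (𝓝 (φ s)))
    (h2 : φ 2 < 2 ^ (-p)) :
    Tendsto (fun t => (∫ m in Set.Ioi t, G m) / (t * G t)) atTop (𝓝 (∫ s in Set.Ioi 1, φ s)) := by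
  obtain ⟨T, hT⟩ := eventually_atTop.1 ((hφ 2 one_lt_two).eventually (gt_mem_nhds h2))
  have hpow : ∀ t, 0 < t → T ≤ t → ∀ k : ℕ, G (2 ^ k * t) ≤ (2 ^ (-p)) ^ k * G t := by
    intro t ht0 htT k
    induction k with
    | zero => simp
    | succ k ih =>
      have h1 : T ≤ 2 ^ k * t := htT.trans (le_mul_of_one_le_left ht0.le (one_le_pow₀ one_le_two))
      have h3 := hT _ h1
      rw [div_lt_iff₀ (hpos _)] at h3
      have h4 : (2 : ℝ) ^ (k + 1) * t = 2 * (2 ^ k * t) := by ring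
      have h5 : (0 : ℝ) < 2 ^ (-p) := by positivity
      rw [h4, pow_succ]
      calc _ ≤ _ := h3.le
        _ ≤ 2 ^ (-p) * ((2 ^ (-p)) ^ k * G t) := mul_le_mul_of_nonneg_left ih h5.le
        _ = _ := by ring
  -- Potter-type domination from the single ratio at `2`: between consecutive powers of `2` only
  -- monotonicity is used, which costs the factor `2 ^ p`.
  have hbound : ∀ t, 0 < t → T ≤ t → ∀ s, 1 < s → G (s * t) / G t ≤ 2 ^ p * s ^ (-p) := by
    intro t ht0 htT s hs
    obtain ⟨k, hk1, hk2⟩ := exists_nat_pow_near hs.le one_lt_two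
    rw [div_le_iff₀ (hpos t)]
    have h1 : G (s * t) ≤ G (2 ^ k * t) := hG (mul_le_mul_of_nonneg_right hk1 ht0.le)
    refine (h1.trans (hpow t ht0 htT k)).trans (mul_le_mul_of_nonneg_right ?_ (hpos t).le)
    have h3 : ((2 : ℝ) ^ (k + 1)) ^ (-p) ≤ s ^ (-p) :=
      Real.rpow_le_rpow_of_nonpos (by linarith) hk2.le (by linarith)
    have h4 : ((2 : ℝ) ^ (-p)) ^ k = 2 ^ p * ((2 : ℝ) ^ (k + 1)) ^ (-p) := by
      rw [← Real.rpow_natCast, ← Real.rpow_natCast, ← Real.rpow_mul (by norm_num),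
        ← Real.rpow_mul (by norm_num), ← Real.rpow_add (by norm_num)]
      congr 1
      push_cast
      ring
    rw [h4]
    exact mul_le_mul_of_nonneg_left h3 (by positivity)
  have hlim : Tendsto (fun t => ∫ s in Set.Ioi (1 : ℝ), G (s * t) / G t) atTop
      (𝓝 (∫ s in Set.Ioi 1, φ s)) := by
    refine tendsto_integral_filter_of_dominated_convergence (fun s => 2 ^ p * s ^ (-p))
      (Eventually.of_forall fun t => ?_) ?_ ?_ ?_
    · exact ((hG.measurable.comp (measurable_id.mul_const t)).div_const _).aestronglyMeasurable
    · filter_upwards [eventually_gt_atTop 0, eventually_ge_atTop T] with t h0 h1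
      filter_upwards [ae_restrict_mem measurableSet_Ioi] with s hs
      rw [Real.norm_of_nonneg (div_nonneg (hpos _).le (hpos _).le)]
      exact hbound t h0 h1 s hs
    · exact (integrableOn_Ioi_rpow_of_lt (by linarith) one_pos).const_mul _
    · filter_upwards [ae_restrict_mem measurableSet_Ioi] with s hs
      exact hφ s hs
  refine hlim.congr' ?_
  filter_upwards [eventually_gt_atTop 0] with t ht
  have := integral_comp_mul_left_Ioi G 1 ht
  rw [mul_one, smul_eq_mul] at this
  rw [integral_div]
  simp only [mul_comm t] at this
  rw [this]
  field_simp

/-- After substituting `m = x - s (x - t)` the ratio is at most `1` by monotonicity, so dominated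
convergence on `(0, 1)` needs no Potter bound. -/
theorem tendsto_setIntegral_Ioi_div_endpoint {G φ : ℝ → ℝ} (hG : Antitone G) (hG0 : ∀ t, 0 ≤ G t)
    {x : ℝ} (hx : ∀ t, 0 < G t ↔ t < x)
    (hφ : ∀ s ∈ Set.Ioo (0 : ℝ) 1,
      Tendsto (fun t => G (x - s * (x - t)) / G t) (tailFilter G) (𝓝 (φ s))) :
    Tendsto (fun t => (∫ m in Set.Ioi t, G m) / ((x - t) * G t)) (tailFilter G)
      (𝓝 (∫ s in (0 : ℝ)..1, φ s)) := by
  have hlim : Tendsto (fun t => ∫ s in (0 : ℝ)..1, G (x - s * (x - t)) / G t) (tailFilter G)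
      (𝓝 (∫ s in (0 : ℝ)..1, φ s)) := by
    refine intervalIntegral.tendsto_integral_filter_of_dominated_convergence (fun _ => 1)
      (Eventually.of_forall fun t => ?_) ?_ ?_ ?_
    · refine ((hG.measurable.comp ?_).div_const _).aestronglyMeasurable
      fun_prop
    · filter_upwards [eventually_pos_tailFilter] with t ht
      refine Eventually.of_forall fun s hs => ?_
      rw [Set.uIoc_of_le zero_le_one] at hs
      rw [Real.norm_of_nonneg (div_nonneg (hG0 _) ht.le)]
      refine div_le_one_of_le₀ (hG ?_) ht.le
      have := (hx t).1 ht
      nlinarith [hs.2]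
    · exact intervalIntegrable_const
    · have : ∀ᵐ s : ℝ, s ≠ 1 := by simp [ae_iff]
      filter_upwards [this] with s hs1 hs
      rw [Set.uIoc_of_le zero_le_one] at hs
      exact hφ s ⟨hs.1, lt_of_le_of_ne hs.2 hs1⟩
  refine hlim.congr' ?_
  filter_upwards [eventually_pos_tailFilter] with t ht
  have htx := (hx t).1 ht
  have h1 : ∫ m in Set.Ioi t, G m = ∫ m in t..x, G m := by
    rw [intervalIntegral.integral_of_le htx.le]
    refine (setIntegral_eq_of_subset_of_forall_sdiff_eq_zero measurableSet_Ioi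
      Set.Ioc_subset_Ioi_self fun m hm => ?_)
    refine le_antisymm (not_lt.1 fun h => hm.2 ⟨hm.1, ((hx m).1 h).le⟩) (hG0 m)
  have h2 := intervalIntegral.integral_comp_sub_mul (a := 0) (b := 1) G
    (sub_ne_zero.2 htx.ne') x
  rw [mul_one, mul_zero, sub_sub_cancel, sub_zero, smul_eq_mul] at h2
  rw [intervalIntegral.integral_div, h1]
  simp only [mul_comm (x - t)] at h2
  rw [h2]
  have : x - t ≠ 0 := sub_ne_zero.2 htx.ne'
  field_simp

/-! ### Quantile, expectile and their shortfalls in terms of tail and stop-loss. -/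

/-- The tail `P[L > m]`. -/
noncomputable def lossTail {Ω : Type*} [MeasurableSpace Ω] (P : Measure Ω) (L : Ω → ℝ)
    (m : ℝ) : ℝ := 1 - lossCDF P L m

/-- The stop-loss transform `E[(L - m)⁺]`. -/
noncomputable def stopLoss {Ω : Type*} [MeasurableSpace Ω] (P : Measure Ω) (L : Ω → ℝ)
    (m : ℝ) : ℝ := ∫ ω, (L ω - m)⁺ ∂P

section

variable {Ω : Type*} [MeasurableSpace Ω] (P : Measure Ω) (L : Ω → ℝ)

theorem lossTail_antitone : Antitone (lossTail P L) := fun _ _ h =>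
  sub_le_sub_left (ProbabilityTheory.monotone_cdf _ h) _

theorem lossTail_nonneg (m : ℝ) : 0 ≤ lossTail P L m :=
  sub_nonneg.2 (ProbabilityTheory.cdf_le_one _ m)

theorem tendsto_lossTail_atTop : Tendsto (lossTail P L) atTop (𝓝 0) := by
  have := (ProbabilityTheory.tendsto_cdf_atTop (P.map L)).const_sub 1
  norm_num at this
  exact this

theorem tendsto_lossTail_atBot : Tendsto (lossTail P L) atBot (𝓝 1) := by
  have := (ProbabilityTheory.tendsto_cdf_atBot (P.map L)).const_sub 1
  norm_num at this
  exact this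

theorem lossTail_rightContinuous (m : ℝ) : Tendsto (lossTail P L) (𝓝[>] m) (𝓝 (lossTail P L m)) :=
  (((ProbabilityTheory.cdf (P.map L)).right_continuous m).tendsto.mono_left
    (nhdsWithin_mono _ Set.Ioi_subset_Ici_self)).const_sub 1

/-- Right continuity of the tail makes the infimum attained, so quantile and tail form a Galois
connection. -/
theorem quantile_le_iff {α : ℝ} (h0 : 0 < α) (h1 : α < 1) {m : ℝ} :
    quantile P L α ≤ m ↔ lossTail P L m ≤ α := by
  set A := {m : ℝ | lossCDF P L m ≥ 1 - α} with hA
  have hmem : ∀ m, m ∈ A ↔ lossTail P L m ≤ α := fun m => by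
    simp only [hA, Set.mem_ofPred_eq, lossTail]
    constructor <;> intro h <;> linarith
  have hne : A.Nonempty := by
    obtain ⟨m, hm⟩ := ((tendsto_lossTail_atTop P L).eventually (ge_mem_nhds h0)).exists
    exact ⟨m, (hmem m).2 hm⟩
  have hbdd : BddBelow A := by
    obtain ⟨m, hm⟩ := ((tendsto_lossTail_atBot P L).eventually (lt_mem_nhds h1)).exists
    refine ⟨m, fun b hb => ?_⟩
    exact ((lossTail_antitone P L).reflect_lt (((hmem b).1 hb).trans_lt hm)).le
  refine ⟨fun h => ?_, fun h => csInf_le hbdd ((hmem m).2 h)⟩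
  refine le_of_tendsto (lossTail_rightContinuous P L m) ?_
  filter_upwards [self_mem_nhdsWithin] with b hb
  obtain ⟨b', hb', hlt⟩ := exists_lt_of_csInf_lt hne (lt_of_le_of_lt h hb)
  exact (lossTail_antitone P L hlt.le).trans ((hmem b').1 hb')

theorem lossTail_quantile_le {α : ℝ} (h0 : 0 < α) (h1 : α < 1) :
    lossTail P L (quantile P L α) ≤ α := (quantile_le_iff P L h0 h1).1 le_rfl

theorem lt_quantile_iff {α : ℝ} (h0 : 0 < α) (h1 : α < 1) {m : ℝ} :
    m < quantile P L α ↔ α < lossTail P L m := by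
  rw [← not_le, quantile_le_iff P L h0 h1, not_le]

theorem quantile_antitoneOn : AntitoneOn (quantile P L) (Set.Ioo 0 1) := fun _ hu _ hv huv =>
  (quantile_le_iff P L hv.1 hv.2).2 ((lossTail_quantile_le P L hu.1 hu.2).trans huv)

omit [MeasurableSpace Ω] in
theorem setOf_lt_posPart {L : Ω → ℝ} {m t : ℝ} (ht : 0 ≤ t) :
    {ω | t < (L ω - m)⁺} = {ω | m + t < L ω} := by
  ext ω
  simp only [Set.mem_ofPred_eq, posPart_def, lt_sup_iff, not_lt.2 ht, or_false]
  exact lt_sub_iff_add_lt'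

theorem stopLoss_nonneg (m : ℝ) : 0 ≤ stopLoss P L m := integral_nonneg fun _ => posPart_nonneg _

variable [IsProbabilityMeasure P] {L} (hL : Integrable L P)
include hL

theorem lossTail_eq (m : ℝ) : lossTail P L m = P.real {ω | m < L ω} := by
  have hm := hL.aestronglyMeasurable.aemeasurable
  have : IsProbabilityMeasure (P.map L) := Measure.isProbabilityMeasure_map hm
  rw [lossTail, lossCDF, ProbabilityTheory.cdf_eq_real, ← probReal_compl_eq_one_sub measurableSet_Iic,
    Set.compl_Iic, map_measureReal_apply_of_aemeasurable hm measurableSet_Ioi]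
  rfl

theorem integrable_sub_posPart (m : ℝ) : Integrable (fun ω => (L ω - m)⁺) P :=
  (hL.sub (integrable_const m)).pos_part

theorem stopLoss_antitone : Antitone (stopLoss P L) := fun m m' h =>
  integral_mono (integrable_sub_posPart P hL m') (integrable_sub_posPart P hL m) fun ω =>
    posPart_mono (by linarith)

theorem stopLoss_eq (m : ℝ) : stopLoss P L m = ∫ t in Set.Ioi m, lossTail P L t := by
  rw [stopLoss, (integrable_sub_posPart P hL m).integral_eq_integral_meas_lt
    (Eventually.of_forall fun _ => posPart_nonneg _)]
  have h1 : ∫ t in Set.Ioi (0 : ℝ), P.real {ω | t < (L ω - m)⁺}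
      = ∫ t in Set.Ioi (0 : ℝ), lossTail P L (m + t) := by
    refine setIntegral_congr_fun measurableSet_Ioi fun t ht => ?_
    rw [setOf_lt_posPart (le_of_lt ht), lossTail_eq P hL]
  rw [h1]
  have := (measurePreserving_add_left volume m).setIntegral_preimage_emb
    (measurableEmbedding_addLeft m) (lossTail P L) (Set.Ioi m)
  simpa using this

theorem mul_lossTail_le_stopLoss {m m' : ℝ} (h : m ≤ m') :
    (m' - m) * lossTail P L m' ≤ stopLoss P L m := by
  refine le_trans (mul_le_mul_of_nonneg_left ?_ (sub_nonneg.2 h))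
    (mul_meas_ge_le_integral_of_nonneg (Eventually.of_forall fun ω => posPart_nonneg (L ω - m))
    (integrable_sub_posPart P hL m) (m' - m))
  rw [lossTail_eq P hL]
  refine measureReal_mono fun ω hω => ?_
  simp only [Set.mem_ofPred_eq] at hω ⊢
  exact le_trans (by linarith) (le_posPart _)

/-- Layer cake: `q_u - q_α` on `(0, α]` and `(L - q_α)⁺` under `P` both exceed `t > 0` on a set of
measure `G(q_α + t)`. Atoms of `L` do no harm. -/
theorem quantile_integral {α : ℝ} (h0 : 0 < α) (h1 : α < 1) :
    IntegrableOn (quantile P L) (Set.Ioc 0 α) ∧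
      ∫ u in (0 : ℝ)..α, quantile P L u = α * quantile P L α + stopLoss P L (quantile P L α) := by
  set q := quantile P L α with hq
  set f : ℝ → ℝ := fun u => quantile P L u - q with hf
  have hsub : Set.Ioc 0 α ⊆ Set.Ioo 0 1 := fun u hu => ⟨hu.1, hu.2.trans_lt h1⟩
  have hm : AEMeasurable f (volume.restrict (Set.Ioc 0 α)) :=
    (aemeasurable_restrict_of_antitoneOn measurableSet_Ioc
      ((quantile_antitoneOn P L).mono hsub)).sub_const _
  have hnn : 0 ≤ᵐ[volume.restrict (Set.Ioc 0 α)] f := by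
    filter_upwards [ae_restrict_mem measurableSet_Ioc] with u hu
    exact sub_nonneg.2 (quantile_antitoneOn P L (hsub hu) ⟨h0, h1⟩ hu.2)
  have e : ∫⁻ u in Set.Ioc 0 α, ENNReal.ofReal (f u) = ∫⁻ ω, ENNReal.ofReal ((L ω - q)⁺) ∂P := by
    rw [lintegral_eq_lintegral_meas_lt _ hnn hm, lintegral_eq_lintegral_meas_lt _
      (Eventually.of_forall fun _ => posPart_nonneg _)
      (integrable_sub_posPart P hL q).aestronglyMeasurable.aemeasurable]
    refine setLIntegral_congr_fun measurableSet_Ioi fun t ht => ?_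
    have ht : 0 < t := ht
    rw [setOf_lt_posPart ht.le, ← ENNReal.ofReal_toReal (measure_ne_top P _)]
    have : (P {ω | q + t < L ω}).toReal = lossTail P L (q + t) := (lossTail_eq P hL _).symm
    rw [this, Measure.restrict_apply' measurableSet_Ioc]
    have hset : {u | t < f u} ∩ Set.Ioc 0 α = Set.Ioo 0 (lossTail P L (q + t)) := by
      have hle : lossTail P L (q + t) ≤ α :=
        (lossTail_antitone P L (by linarith)).trans (lossTail_quantile_le P L h0 h1)
      ext u
      simp only [hf, Set.mem_inter_iff, Set.mem_ofPred_eq, Set.mem_Ioc, Set.mem_Ioo]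
      constructor
      · rintro ⟨h2, h3, h4⟩
        exact ⟨h3, (lt_quantile_iff P L h3 (h4.trans_lt h1)).1 (by linarith)⟩
      · rintro ⟨h2, h3⟩
        have h4 : u ≤ α := h3.le.trans hle
        have := (lt_quantile_iff P L h2 (h4.trans_lt h1)).2 h3
        exact ⟨by linarith, h2, h4⟩
    rw [hset, Real.volume_Ioo, sub_zero]
  have hfi : IntegrableOn f (Set.Ioc 0 α) := by
    refine ⟨hm.aestronglyMeasurable, ?_⟩
    rw [hasFiniteIntegral_iff_ofReal hnn, e]
    exact (hasFiniteIntegral_iff_ofReal (Eventually.of_forall fun _ => posPart_nonneg _)).1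
      (integrable_sub_posPart P hL q).2
  have hqi : IntegrableOn (quantile P L) (Set.Ioc 0 α) := by
    have := hfi.add (integrable_const (μ := volume.restrict (Set.Ioc 0 α)) q)
    exact this.congr (Eventually.of_forall fun u => by simp [hf])
  refine ⟨hqi, ?_⟩
  have h2 : ∫ u in Set.Ioc 0 α, f u = stopLoss P L q := by
    rw [stopLoss, integral_eq_lintegral_of_nonneg_ae hnn hm.aestronglyMeasurable, e,
      integral_eq_lintegral_of_nonneg_ae (Eventually.of_forall fun _ => posPart_nonneg _)
      (integrable_sub_posPart P hL q).aestronglyMeasurable]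
  rw [intervalIntegral.integral_of_le h0.le]
  have h3 : ∫ u in Set.Ioc 0 α, f u = (∫ u in Set.Ioc 0 α, quantile P L u) - α * q := by
    simp only [hf]
    rw [integral_sub hqi (integrable_const _)]
    simp [h0.le]
  linarith

theorem expectedShortfall_eq {α : ℝ} (h0 : 0 < α) (h1 : α < 1) :
    expectedShortfall P L α = quantile P L α + stopLoss P L (quantile P L α) / α := by
  rw [expectedShortfall, (quantile_integral P hL h0 h1).2]
  field_simp

/-- Eliminates the negative part through `y⁺ - y⁻ = y`. -/
theorem isExpectile_iff {α m : ℝ} :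
    IsExpectile P L α m ↔ (1 - 2 * α) * stopLoss P L m = α * (m - ∫ ω, L ω ∂P) := by
  have hneg : ∫ ω, (L ω - m)⁻ ∂P = stopLoss P L m - (∫ ω, L ω ∂P) + m := by
    have h1 : ∫ ω, ((L ω - m)⁺ - (L ω - m)⁻) ∂P = (∫ ω, L ω ∂P) - m := by
      simp only [posPart_sub_negPart]
      rw [integral_sub hL (integrable_const m)]
      simp
    have hn : Integrable (fun ω => (L ω - m)⁻) P := (hL.sub (integrable_const m)).neg_part
    rw [integral_sub (integrable_sub_posPart P hL m) hn] at h1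
    rw [stopLoss]
    linarith
  rw [IsExpectile, hneg, ← stopLoss]
  constructor <;> intro h <;> linarith

theorem expectile_eq {α : ℝ} (h0 : 0 < α) (h1 : α ≤ 1 / 2) :
    (1 - 2 * α) * stopLoss P L (expectile P L α) = α * (expectile P L α - ∫ ω, L ω ∂P) :=
  (isExpectile_iff P hL).1 (Classical.epsilon_spec (existsUnique_isExpectile P hL h0 h1).exists)

/-- The left side is strictly increasing in `m`, the right side is nonincreasing, and they agree at
the expectile. -/
theorem lt_expectile_iff {α : ℝ} (h0 : 0 < α) (h1 : α ≤ 1 / 2) {m : ℝ} :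
    m < expectile P L α ↔ α * (m - ∫ ω, L ω ∂P) < (1 - 2 * α) * stopLoss P L m := by
  have he := expectile_eq P hL h0 h1
  rcases lt_or_ge m (expectile P L α) with h | h
  · have := mul_le_mul_of_nonneg_left (stopLoss_antitone P hL h.le) (show 0 ≤ 1 - 2 * α by linarith)
    have := mul_lt_mul_of_pos_left h h0
    exact iff_of_true h (by linarith)
  · have := mul_le_mul_of_nonneg_left (stopLoss_antitone P hL h) (show 0 ≤ 1 - 2 * α by linarith)
    have := mul_le_mul_of_nonneg_left h h0.le
    exact iff_of_false h.not_gt (by linarith)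

theorem mean_le_expectile {α : ℝ} (h0 : 0 < α) (h1 : α ≤ 1 / 2) :
    ∫ ω, L ω ∂P ≤ expectile P L α := by
  have he := expectile_eq P hL h0 h1
  have := mul_nonneg (show 0 ≤ 1 - 2 * α by linarith)
    (stopLoss_nonneg P L (expectile P L α))
  rw [he] at this
  linarith [nonneg_of_mul_nonneg_right this h0]

theorem expectile_antitoneOn : AntitoneOn (expectile P L) (Set.Ioc 0 (1 / 2)) := by
  intro u hu v hv huv
  by_contra! hlt
  have h1 := (lt_expectile_iff P hL hv.1 hv.2).1 hlt
  have h2 := expectile_eq P hL hu.1 hu.2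
  have h3 := mean_le_expectile P hL hu.1 hu.2
  nlinarith [stopLoss_nonneg P L (expectile P L u)]

theorem expectileTCE_eq {α : ℝ} (h : 0 < lossTail P L (expectile P L α)) :
    expectileTCE P L α = expectile P L α +
      stopLoss P L (expectile P L α) / lossTail P L (expectile P L α) := by
  set e := expectile P L α
  set s := {ω | e < L ω} with hs
  have hm := hL.aestronglyMeasurable.aemeasurable
  have hsm : NullMeasurableSet s P := hm.nullMeasurableSet_preimage measurableSet_Ioi
  have h1 : ∫ ω in s, (L ω - e) ∂P = stopLoss P L e := by
    have h0 : ∀ ω, ω ∉ s → (L ω - e)⁺ = 0 := fun ω hω =>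
      posPart_eq_zero.2 (sub_nonpos.2 (le_of_not_gt hω))
    rw [stopLoss, ← setIntegral_eq_integral_of_forall_compl_eq_zero h0]
    · refine integral_congr_ae ?_
      filter_upwards [ae_restrict_mem₀ hsm] with ω hω
      exact (posPart_eq_self.2 (sub_nonneg.2 (le_of_lt hω))).symm
  rw [integral_sub hL.integrableOn (integrable_const _)] at h1
  have h2 : P.real s = lossTail P L e := (lossTail_eq P hL e).symm
  simp only [integral_const, measureReal_restrict_apply_univ, smul_eq_mul, h2] at h1
  have h3 : expectileTCE P L α = (lossTail P L e)⁻¹ * ∫ ω in s, L ω ∂P := by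
    rw [expectileTCE, ProbabilityTheory.cond, integral_smul_measure, ENNReal.toReal_inv, ← h2]
    rfl
  rw [h3]
  field_simp
  linarith

end
end ExpectileRisk
-- Averaging relations near zero, endpoints, and the limits of quantile and expectile.
namespace ExpectileRisk

theorem isLittleO_integral_of_isLittleO {f g : ℝ → ℝ} (h : f =o[𝓝[>] 0] g)
    (hg0 : ∀ᶠ u in 𝓝[>] 0, 0 ≤ g u) {δ : ℝ} (hδ : 0 < δ) (hg : IntegrableOn g (Set.Ioc 0 δ)) :
    (fun α => ∫ u in (0 : ℝ)..α, f u) =o[𝓝[>] 0] fun α => ∫ u in (0 : ℝ)..α, g u := by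
  refine isLittleO_iff.2 fun c hc => ?_
  obtain ⟨ε, hε, H⟩ := (nhdsGT_basis (0 : ℝ)).eventually_iff.1 ((isLittleO_iff.1 h hc).and hg0)
  filter_upwards [Ioo_mem_nhdsGT (lt_min hε hδ)] with α hα
  have h1 : α < ε := hα.2.trans_le (min_le_left _ _)
  have h2 : α < δ := hα.2.trans_le (min_le_right _ _)
  have hmem : ∀ u ∈ Set.Ioc 0 α, u ∈ Set.Ioo 0 ε := fun u hu => ⟨hu.1, hu.2.trans_lt h1⟩
  have hgi : IntervalIntegrable g volume 0 α :=
    (intervalIntegrable_iff_integrableOn_Ioc_of_le hα.1.le).2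
      (hg.mono_set (Set.Ioc_subset_Ioc_right h2.le))
  have := intervalIntegral.norm_integral_le_of_norm_le (f := f) (g := fun u => c * g u) hα.1.le
    (Eventually.of_forall fun u hu => by
      obtain ⟨h3, h4⟩ := H (hmem u hu)
      rwa [Real.norm_of_nonneg h4] at h3) (hgi.const_mul c)
  rw [intervalIntegral.integral_const_mul] at this
  exact this.trans (mul_le_mul_of_nonneg_left (le_abs_self _) hc.le)

theorem isEquivalent_of_tendsto_const {ι : Type*} {l : Filter ι} {f g : ι → ℝ} {c : ℝ}
    (hc : c ≠ 0) (hf : Tendsto f l (𝓝 c)) (hg : Tendsto g l (𝓝 c)) : f ~[l] g :=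
  ((isEquivalent_const_iff_tendsto hc).2 hf).trans ((isEquivalent_const_iff_tendsto hc).2 hg).symm

theorem tailFilter_le_nhds {G : ℝ → ℝ} (hG : Antitone G) {x : ℝ} (hx : ∀ t, 0 < G t ↔ t < x) :
    tailFilter G ≤ 𝓝 x := by
  have : Tendsto id (tailFilter G) (𝓝 x) := by
    refine tendsto_order.2 ⟨fun b hb => ?_, fun b hb => ?_⟩
    · exact eventually_tailFilter.2 ⟨G b, (hx b).2 hb, fun t _ ht => hG.reflect_lt ht⟩
    · filter_upwards [eventually_pos_tailFilter] with t ht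
      exact ((hx t).1 ht).trans hb
  exact this

theorem eventually_nhdsGT_zero_lt {δ : ℝ} (hδ : 0 < δ) : ∀ᶠ α in 𝓝[>] (0 : ℝ), 0 < α ∧ α < δ :=
  Ioo_mem_nhdsGT hδ

section

variable {Ω : Type*} [MeasurableSpace Ω] (P : Measure Ω) (L : Ω → ℝ)

/-- The recentring `y` moves the point where `H = exp(-1)` to the origin, as `V 0 = 1` demands: `1`
for Fréchet, `-1` for Weibull, `0` for Gumbel. -/
theorem exists_tailLimit_of_MDA {H : ℝ → ℝ} (hM : MDA (lossCDF P L) H)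
    {S : Set ℝ} {V : ℝ → ℝ} (y : ℝ) (hS : IsOpen S) (h0 : 0 ∈ S) (hV : ContinuousOn V S)
    (hVa : StrictAntiOn V S) (hV0 : V 0 = 1) (hVp : ∀ z ∈ S, 0 < V z)
    (hH : ∀ z ∈ S, H (z + y) = Real.exp (-V z)) :
    ∃ a, TailLimit (lossTail P L) a S V := by
  obtain ⟨c, d, hc, hcd⟩ := hM
  refine exists_tailLimit (lossTail_antitone P L) (c := c) (d := fun n => d n + c n * y) hc hS h0
    hV hVa hV0 hVp fun z hz => ?_
  have h1 := hcd (z + y)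
  rw [hH z hz] at h1
  have := tendsto_mul_one_sub_of_pow (Real.exp_pos _)
    (fun n => ProbabilityTheory.cdf_nonneg _ _) h1
  rw [Real.log_exp, neg_neg] at this
  refine this.congr fun n => ?_
  rw [lossTail]
  congr 3
  ring

theorem exists_tailLimit_frechet {η : ℝ} (hη : 0 < η) (hM : MDA (lossCDF P L) (frechetCDF η)) :
    ∃ a, TailLimit (lossTail P L) a (Set.Ioi (-1)) fun z => (1 + z) ^ (-η) := by
  have hp : ∀ z ∈ Set.Ioi (-1 : ℝ), 0 < 1 + z := fun z hz => by
    have : -1 < z := hz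
    linarith
  refine exists_tailLimit_of_MDA P L hM 1 isOpen_Ioi (by norm_num) ?_ ?_ (by simp) ?_ ?_
  · exact ContinuousOn.rpow_const (by fun_prop) fun z hz => Or.inl (hp z hz).ne'
  · intro z hz w hw hzw
    exact Real.rpow_lt_rpow_of_neg (hp z hz) (by linarith) (by linarith)
  · exact fun z hz => Real.rpow_pos_of_pos (hp z hz) _
  · intro z hz
    rw [frechetCDF, add_comm, if_pos (hp z hz)]

theorem exists_tailLimit_weibull {η : ℝ} (hη : 0 < η) (hM : MDA (lossCDF P L) (weibullCDF η)) :
    ∃ a, TailLimit (lossTail P L) a (Set.Iio 1) fun z => (1 - z) ^ η := by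
  have hp : ∀ z ∈ Set.Iio (1 : ℝ), 0 < 1 - z := fun z hz => sub_pos.2 hz
  refine exists_tailLimit_of_MDA P L hM (-1) isOpen_Iio (by norm_num) ?_ ?_ (by simp) ?_ ?_
  · exact ContinuousOn.rpow_const (by fun_prop) fun z hz => Or.inl (hp z hz).ne'
  · intro z hz w hw hzw
    exact Real.rpow_lt_rpow (hp w hw).le (by linarith) hη
  · exact fun z hz => Real.rpow_pos_of_pos (hp z hz) _
  · intro z hz
    rw [weibullCDF, if_pos (by linarith [hp z hz])]
    congr 3
    ring

theorem exists_tailLimit_gumbel (hM : MDA (lossCDF P L) gumbelCDF) :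
    ∃ a, TailLimit (lossTail P L) a Set.univ fun z => Real.exp (-z) := by
  refine exists_tailLimit_of_MDA P L hM 0 isOpen_univ trivial (by fun_prop) ?_ (by simp)
    (fun z _ => Real.exp_pos _) ?_
  · intro z _ w _ hzw
    exact Real.exp_lt_exp.2 (neg_lt_neg hzw)
  · intro z _
    rw [gumbelCDF, add_zero]

theorem lossCDF_lt_one_iff {m : ℝ} : lossCDF P L m < 1 ↔ 0 < lossTail P L m := sub_pos.symm

theorem lossTail_pos_of_rightEndpoint {m : ℝ} (h : (m : EReal) < rightEndpoint (lossCDF P L)) :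
    0 < lossTail P L m := by
  obtain ⟨_, ⟨b, hb, rfl⟩, hmb⟩ := lt_sSup_iff.1 h
  exact ((lossCDF_lt_one_iff P L).1 hb).trans_le
    (lossTail_antitone P L (EReal.coe_lt_coe_iff.1 hmb).le)

theorem le_rightEndpoint {m : ℝ} (h : 0 < lossTail P L m) :
    (m : EReal) ≤ rightEndpoint (lossCDF P L) :=
  le_sSup ⟨m, (lossCDF_lt_one_iff P L).2 h, rfl⟩

theorem lossTail_pos_iff {x : ℝ} (hx : rightEndpoint (lossCDF P L) = (x : EReal)) (t : ℝ) :
    0 < lossTail P L t ↔ t < x := by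
  refine ⟨fun h => ?_, fun h => lossTail_pos_of_rightEndpoint P L
    (hx ▸ EReal.coe_lt_coe_iff.2 h)⟩
  obtain ⟨b, hb, htb⟩ := (((lossTail_rightContinuous P L t).eventually (lt_mem_nhds h)).and
    self_mem_nhdsWithin).exists
  have := le_rightEndpoint P L hb
  rw [hx, EReal.coe_le_coe_iff] at this
  exact lt_of_lt_of_le htb this

theorem exists_rightEndpoint_eq {B : ℝ} (hB : ∀ s, 0 < lossTail P L s → s ≤ B) :
    ∃ x : ℝ, rightEndpoint (lossCDF P L) = (x : EReal) := by
  have h1 : rightEndpoint (lossCDF P L) ≤ B := by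
    refine sSup_le ?_
    rintro _ ⟨m, hm, rfl⟩
    exact EReal.coe_le_coe_iff.2 (hB m ((lossCDF_lt_one_iff P L).1 hm))
  obtain ⟨m, hm⟩ := ((tendsto_lossTail_atBot P L).eventually (lt_mem_nhds one_pos)).exists
  have h2 := le_rightEndpoint P L hm
  exact ⟨_, (EReal.coe_toReal (h1.trans_lt (EReal.coe_lt_top B)).ne
    ((EReal.bot_lt_coe m).trans_le h2).ne').symm⟩

theorem tendsto_quantile_tailFilter (hne : (tailFilter (lossTail P L)).NeBot) :
    Tendsto (quantile P L) (𝓝[>] 0) (tailFilter (lossTail P L)) := by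
  rw [tendsto_tailFilter, tendsto_nhdsWithin_iff]
  constructor
  · refine tendsto_of_tendsto_of_tendsto_of_le_of_le' tendsto_const_nhds
      (tendsto_id.mono_left nhdsWithin_le_nhds)
      (Eventually.of_forall fun α => lossTail_nonneg P L _) ?_
    filter_upwards [eventually_nhdsGT_zero_lt one_pos] with α hα
    exact lossTail_quantile_le P L hα.1 hα.2
  · filter_upwards [eventually_nhdsGT_zero_lt one_pos] with α hα
    have : ∀ᶠ m in tailFilter (lossTail P L), 0 < lossTail P L m ∧ lossTail P L m < α :=
      eventually_tailFilter.2 ⟨α, hα.1, fun t h1 h2 => ⟨h1, h2⟩⟩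
    obtain ⟨m, h1, h2⟩ := this.exists
    exact h1.trans_le (lossTail_antitone P L ((quantile_le_iff P L hα.1 hα.2).2 h2.le))

/-- `G(q) ≤ α` always. Any point left of `q` has tail above `α`, and a point `|z|` scales to the
left has tail about `V z · G(q)`, with `V z` close to `1` for small `z`. So jumps of `G` are
asymptotically negligible. -/
theorem tendsto_lossTail_quantile_div {a V : ℝ → ℝ} {S : Set ℝ}
    (h : TailLimit (lossTail P L) a S V) :
    Tendsto (fun α => lossTail P L (quantile P L α) / α) (𝓝[>] 0) (𝓝 1) := by
  have hq := tendsto_quantile_tailFilter P L h.neBot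
  refine tendsto_order.2 ⟨fun b hb => ?_, fun b hb => ?_⟩
  · rcases le_or_gt b 0 with hb0 | hb0
    · filter_upwards [eventually_nhdsGT_zero_lt one_pos,
        hq.eventually eventually_pos_tailFilter] with α hα h1
      exact hb0.trans_lt (div_pos h1 hα.1)
    · have hV : ContinuousAt V 0 := h.continuousOn.continuousAt (h.isOpen.mem_nhds h.zero_mem)
      have hev : ∀ᶠ z in 𝓝[<] (0 : ℝ), b * V z < 1 ∧ z ∈ S := by
        refine mem_nhdsWithin_of_mem_nhds (Filter.inter_mem ?_ (h.isOpen.mem_nhds h.zero_mem))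
        exact (hV.const_mul b).eventually (gt_mem_nhds (by simpa [h.map_zero] using hb))
      obtain ⟨z, ⟨hz1, hzS⟩, hz0⟩ := (hev.and self_mem_nhdsWithin).exists
      have hz0 : z < 0 := hz0
      filter_upwards [eventually_nhdsGT_zero_lt one_pos,
        hq.eventually eventually_pos_tailFilter,
        hq.eventually (((h.tendsto z hzS).const_mul b).eventually (gt_mem_nhds hz1))]
        with α hα h1 h2
      have h3 : α < lossTail P L (quantile P L α + a (quantile P L α) * z) :=
        (lt_quantile_iff P L hα.1 hα.2).1 (by nlinarith [h.scale_pos (quantile P L α)])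
      rw [← mul_div_assoc, div_lt_one h1] at h2
      rw [lt_div_iff₀ hα.1]
      nlinarith
  · filter_upwards [eventually_nhdsGT_zero_lt one_pos] with α hα
    exact ((div_le_one hα.1).2 (lossTail_quantile_le P L hα.1 hα.2)).trans_lt hb

variable [IsProbabilityMeasure P] {L} (hL : Integrable L P)
include hL

/-- Otherwise `L ≤ E[L]` almost surely, so `L` is almost surely constant and its tail takes only the
values `0` and `1`. -/
theorem stopLoss_mean_pos {m : ℝ} (h0 : 0 < lossTail P L m) (h1 : lossTail P L m < 1) :
    0 < stopLoss P L (∫ ω, L ω ∂P) := by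
  set μ := ∫ ω, L ω ∂P with hμ
  refine (stopLoss_nonneg P L μ).lt_of_ne' fun hz => ?_
  have h2 := (integral_eq_zero_iff_of_nonneg (fun ω => posPart_nonneg (L ω - μ))
    (integrable_sub_posPart P hL μ)).1 hz
  have h3 : 0 ≤ᵐ[P] fun ω => μ - L ω := by
    filter_upwards [h2] with ω hω
    have := posPart_eq_zero.1 hω
    simp only [Pi.zero_apply]
    linarith
  have h4 : ∫ ω, (μ - L ω) ∂P = 0 := by
    rw [integral_sub (integrable_const _) hL, ← hμ]
    simp
  have h5 : ∀ᵐ ω ∂P, L ω = μ := by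
    filter_upwards [(integral_eq_zero_iff_of_nonneg_ae h3 ((integrable_const _).sub hL)).1 h4]
      with ω hω
    simp only [Pi.zero_apply] at hω
    linarith
  rw [lossTail_eq P hL] at h0 h1
  rcases le_or_gt μ m with hm | hm
  · have : P {ω | m < L ω} = 0 := by
      rw [← nonpos_iff_eq_zero, ← ae_iff.1 h5]
      refine measure_mono fun ω hω => ?_
      have hω : m < L ω := hω
      exact (hm.trans_lt hω).ne'
    simp [measureReal_def, this] at h0
  · have : P {ω | m < L ω} = 1 := by
      have : ∀ᵐ ω ∂P, m < L ω := by
        filter_upwards [h5] with ω hω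
        rwa [hω]
      rw [measure_congr (eventuallyEq_univ.2 this), measure_univ]
    simp [measureReal_def, this] at h1

theorem tendsto_expectile_tailFilter (hne : (tailFilter (lossTail P L)).NeBot) :
    Tendsto (expectile P L) (𝓝[>] 0) (tailFilter (lossTail P L)) := by
  have hex : ∀ ε > 0, ∃ m, 0 < lossTail P L m ∧ lossTail P L m < ε := fun ε hε =>
    (eventually_tailFilter (p := fun m => 0 < lossTail P L m ∧ lossTail P L m < ε).2
      ⟨ε, hε, fun t h1 h2 => ⟨h1, h2⟩⟩).exists
  have hlt : ∀ m, 0 < stopLoss P L m → ∀ᶠ α in 𝓝[>] (0 : ℝ), m < expectile P L α := by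
    intro m hm
    have c1 : Tendsto (fun α : ℝ => α * (m - ∫ ω, L ω ∂P)) (𝓝[>] 0) (𝓝 0) := by
      have : Tendsto (fun α : ℝ => α * (m - ∫ ω, L ω ∂P)) (𝓝 0)
        (𝓝 (0 * (m - ∫ ω, L ω ∂P))) := (Continuous.tendsto (by fun_prop) 0)
      rw [zero_mul] at this
      exact this.mono_left nhdsWithin_le_nhds
    have c2 : Tendsto (fun α : ℝ => (1 - 2 * α) * stopLoss P L m) (𝓝[>] 0)
        (𝓝 (stopLoss P L m)) := by
      have : Tendsto (fun α : ℝ => (1 - 2 * α) * stopLoss P L m) (𝓝 0)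
        (𝓝 ((1 - 2 * 0) * stopLoss P L m)) := (Continuous.tendsto (by fun_prop) 0)
      rw [mul_zero, sub_zero, one_mul] at this
      exact this.mono_left nhdsWithin_le_nhds
    filter_upwards [c1.eventually_lt c2 hm, eventually_nhdsGT_zero_lt one_half_pos] with α h1 hα
    exact (lt_expectile_iff P hL hα.1 hα.2.le).2 h1
  rw [tendsto_tailFilter, tendsto_nhdsWithin_iff]
  constructor
  · refine tendsto_order.2 ⟨fun b hb => Eventually.of_forall fun α =>
      hb.trans_le (lossTail_nonneg P L _), fun b hb => ?_⟩
    obtain ⟨m, hm0, hmb⟩ := hex b hb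
    obtain ⟨m', hm0', hmb'⟩ := hex _ hm0
    have hmm := (lossTail_antitone P L).reflect_lt hmb'
    have hpos : 0 < stopLoss P L m :=
      (mul_pos (sub_pos.2 hmm) hm0').trans_le (mul_lossTail_le_stopLoss P hL hmm.le)
    filter_upwards [hlt m hpos] with α hα
    exact (lossTail_antitone P L hα.le).trans_lt hmb
  -- The expectile must stay where the tail is positive: `G(e) = 0` gives `π(e) = 0`, so `e = E[L]`
  -- by the defining equation, but `e > E[L]` for small `α`.
  · obtain ⟨m, hm0, hm1⟩ := hex 1 one_pos
    filter_upwards [hlt _ (stopLoss_mean_pos P hL hm0 hm1),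
      eventually_nhdsGT_zero_lt one_half_pos] with α h1 hα
    refine (lossTail_nonneg P L _).lt_of_ne' fun hz => ?_
    have h2 : stopLoss P L (expectile P L α) = 0 := by
      rw [stopLoss_eq P hL]
      refine setIntegral_eq_zero_of_forall_eq_zero fun t ht => ?_
      exact le_antisymm ((lossTail_antitone P L (le_of_lt ht)).trans hz.le) (lossTail_nonneg P L t)
    have h3 := expectile_eq P hL hα.1 hα.2.le
    rw [h2, mul_zero] at h3
    nlinarith [mul_pos hα.1 (sub_pos.2 h1)]

/-- Domination matters only near `0`; away from it a monotone function on a compact interval is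
integrable. -/
theorem integrableOn_expectile {g : ℝ → ℝ} {δ : ℝ} (hδ : 0 < δ) (hg : IntegrableOn g (Set.Ioc 0 δ))
    (h : (expectile P L) =O[𝓝[>] 0] g) : IntegrableOn (expectile P L) (Set.Ioc 0 (1 / 2)) := by
  obtain ⟨C, hC⟩ := h.bound
  obtain ⟨ε, hε, H⟩ := (nhdsGT_basis (0 : ℝ)).eventually_iff.1 hC
  set ρ := min (min (ε / 2) δ) (1 / 2) with hρ
  have hρ0 : 0 < ρ := lt_min (lt_min (half_pos hε) hδ) one_half_pos
  have hρ1 : ρ ≤ 1 / 2 := min_le_right _ _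
  have hρ2 : ρ ≤ δ := (min_le_left _ _).trans (min_le_right _ _)
  have hρ3 : ρ < ε := ((min_le_left _ _).trans (min_le_left _ _)).trans_lt (half_lt_self hε)
  have hanti := expectile_antitoneOn P hL
  rw [← Set.Ioc_union_Icc_eq_Ioc hρ0 hρ1]
  refine IntegrableOn.union ?_ ?_
  · refine Integrable.mono' (((hg.mono_set (Set.Ioc_subset_Ioc_right hρ2)).norm).const_mul C)
      (aemeasurable_restrict_of_antitoneOn measurableSet_Ioc
        (hanti.mono (Set.Ioc_subset_Ioc_right hρ1))).aestronglyMeasurable ?_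
    filter_upwards [ae_restrict_mem measurableSet_Ioc] with u hu
    exact H ⟨hu.1, hu.2.trans_lt hρ3⟩
  · exact (hanti.mono fun u hu => ⟨hρ0.trans_le hu.1, hu.2⟩).integrableOn_isCompact isCompact_Icc

end
end ExpectileRisk
-- Consequences of a Karamata constant `β`, for infinite and finite endpoint.
namespace ExpectileRisk

section

variable {Ω : Type*} [MeasurableSpace Ω] (P : Measure Ω) [IsProbabilityMeasure P] {L : Ω → ℝ}
  (hL : Integrable L P) {a V : ℝ → ℝ} {S : Set ℝ} (h : TailLimit (lossTail P L) a S V) {β : ℝ}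

theorem tendsto_one_sub_two_mul : Tendsto (fun α : ℝ => 1 - 2 * α) (𝓝[>] 0) (𝓝 1) := by
  have : Tendsto (fun α : ℝ => 1 - 2 * α) (𝓝 0) (𝓝 (1 - 2 * 0)) :=
    Continuous.tendsto (by fun_prop) 0
  rw [mul_zero, sub_zero] at this
  exact this.mono_left nhdsWithin_le_nhds

include hL h

section Unbounded

variable (hl : tailFilter (lossTail P L) = atTop)
  (hβ : Tendsto (fun t => stopLoss P L t / (t * lossTail P L t)) atTop (𝓝 β))
include hl

omit [IsProbabilityMeasure P] hL in
theorem tendsto_quantile_atTop : Tendsto (quantile P L) (𝓝[>] 0) atTop :=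
  hl ▸ tendsto_quantile_tailFilter P L h.neBot

theorem tendsto_expectile_atTop : Tendsto (expectile P L) (𝓝[>] 0) atTop :=
  hl ▸ tendsto_expectile_tailFilter P hL h.neBot

include hβ

theorem tendsto_expectedShortfall_div_quantile :
    Tendsto (fun α => expectedShortfall P L α / quantile P L α) (𝓝[>] 0) (𝓝 (1 + β)) := by
  have hq := tendsto_quantile_atTop P h hl
  have h1 := ((hβ.comp hq).mul (tendsto_lossTail_quantile_div P L h)).const_add 1
  rw [mul_one] at h1
  refine h1.congr' ?_
  filter_upwards [eventually_nhdsGT_zero_lt one_pos, hq.eventually (eventually_gt_atTop 0),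
    (tendsto_quantile_tailFilter P L h.neBot).eventually eventually_pos_tailFilter] with α hα h2 h3
  rw [expectedShortfall_eq P hL hα.1 hα.2]
  have := hα.1
  simp only [Function.comp]
  field_simp

theorem tendsto_expectileTCE_div_expectile :
    Tendsto (fun α => expectileTCE P L α / expectile P L α) (𝓝[>] 0) (𝓝 (1 + β)) := by
  have he := tendsto_expectile_atTop P hL h hl
  refine ((hβ.comp he).const_add 1).congr' ?_
  filter_upwards [he.eventually (eventually_gt_atTop 0),
    (tendsto_expectile_tailFilter P hL h.neBot).eventually eventually_pos_tailFilter] with α h2 h3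
  rw [expectileTCE_eq P hL h3]
  simp only [Function.comp]
  field_simp

/-- The defining equation divided by `e G(e)`; the mean drops out because `e → ∞`. -/
theorem tendsto_div_lossTail_expectile :
    Tendsto (fun α => α / lossTail P L (expectile P L α)) (𝓝[>] 0) (𝓝 β) := by
  have he := tendsto_expectile_atTop P hL h hl
  have h1 : Tendsto (fun α => 1 - (∫ ω, L ω ∂P) / expectile P L α) (𝓝[>] 0) (𝓝 1) := by
    simpa using (he.const_div_atTop (∫ ω, L ω ∂P)).const_sub 1
  have h2 := (tendsto_one_sub_two_mul.mul (hβ.comp he)).div h1 one_ne_zero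
  rw [one_mul, div_one] at h2
  refine h2.congr' ?_
  filter_upwards [he.eventually (eventually_gt_atTop 0),
    he.eventually (eventually_gt_atTop (∫ ω, L ω ∂P)), eventually_nhdsGT_zero_lt one_half_pos,
    (tendsto_expectile_tailFilter P hL h.neBot).eventually eventually_pos_tailFilter]
    with α h3 h4 hα h5
  have h6 := expectile_eq P hL hα.1 hα.2.le
  have h7 : 1 - (∫ ω, L ω ∂P) / expectile P L α ≠ 0 := by
    rw [sub_ne_zero, ne_comm, Ne, div_eq_one_iff_eq h3.ne']
    exact h4.ne
  simp only [Function.comp, Pi.div_apply]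
  rw [div_eq_div_iff h7 h5.ne']
  field_simp
  linear_combination h6

/-- If the expectile is asymptotically proportional to the quantile, then so are the expected
shortfalls built on them. -/
theorem expectileES_isEquivalent_of_tendsto {C : ℝ} (hC : 0 < C) (hβ1 : 1 + β ≠ 0)
    (hCe : Tendsto (fun α => expectile P L α / quantile P L α) (𝓝[>] 0) (𝓝 C)) :
    IntegrableOn (fun u => expectile P L u) (Set.Ioc 0 (1 / 2)) ∧
      (fun α => expectileES P L α) ~[𝓝[>] 0] (fun α => expectileTCE P L α) ∧
      (fun α => expectileTCE P L α) ~[𝓝[>] 0] (fun α => C * expectedShortfall P L α) := by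
  have hq := tendsto_quantile_atTop P h hl
  have hq0 : ∀ᶠ α in 𝓝[>] (0 : ℝ), 0 < quantile P L α := hq.eventually (eventually_gt_atTop 0)
  have heq : (expectile P L) ~[𝓝[>] 0] (fun α => C * quantile P L α) := by
    refine isEquivalent_of_tendsto_one ?_
    have := hCe.div_const C
    rw [div_self hC.ne'] at this
    refine this.congr' (Eventually.of_forall fun α => ?_)
    simp only [Pi.div_apply]
    rw [div_div, mul_comm C]
  have hqi : IntegrableOn (quantile P L) (Set.Ioc 0 (1 / 2)) :=
    (quantile_integral P hL one_half_pos one_half_lt_one).1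
  have hci : IntegrableOn (fun u => C * quantile P L u) (Set.Ioc 0 (1 / 2)) := hqi.const_mul C
  have hei : IntegrableOn (expectile P L) (Set.Ioc 0 (1 / 2)) :=
    integrableOn_expectile P hL one_half_pos hci heq.isBigO
  have hES : (fun α => expectileES P L α) ~[𝓝[>] 0] (fun α => C * expectedShortfall P L α) := by
    have h1 := isLittleO_integral_of_isLittleO heq
      (hq0.mono fun α hα => (mul_pos hC hα).le) one_half_pos hci
    have h2 := (isBigO_refl (fun α : ℝ => 1 / α) (𝓝[>] 0)).mul_isLittleO h1
    refine (h2.congr' ?_ ?_ : (fun α => expectileES P L α - C * expectedShortfall P L α)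
      =o[𝓝[>] 0] (fun α => C * expectedShortfall P L α))
    · filter_upwards [eventually_nhdsGT_zero_lt one_half_pos] with α hα
      have i1 : IntervalIntegrable (expectile P L) volume 0 α :=
        (intervalIntegrable_iff_integrableOn_Ioc_of_le hα.1.le).2
          (hei.mono_set (Set.Ioc_subset_Ioc_right hα.2.le))
      have i2 : IntervalIntegrable (fun u => C * quantile P L u) volume 0 α :=
        (intervalIntegrable_iff_integrableOn_Ioc_of_le hα.1.le).2
          (hci.mono_set (Set.Ioc_subset_Ioc_right hα.2.le))
      simp only [Pi.sub_apply]
      rw [intervalIntegral.integral_sub i1 i2, intervalIntegral.integral_const_mul, expectileES,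
        expectedShortfall]
      ring
    · refine Eventually.of_forall fun α => ?_
      simp only
      rw [intervalIntegral.integral_const_mul, expectedShortfall]
      ring
  have hTCE : (fun α => expectileTCE P L α) ~[𝓝[>] 0]
      (fun α => C * expectedShortfall P L α) := by
    have hr : (fun α => expectileTCE P L α / expectile P L α) ~[𝓝[>] 0]
        (fun α => expectedShortfall P L α / quantile P L α) :=
      isEquivalent_of_tendsto_const hβ1 (tendsto_expectileTCE_div_expectile P hL h hl hβ)
        (tendsto_expectedShortfall_div_quantile P hL h hl hβ)
    refine (heq.mul hr).congr_left ?_ |>.congr_right ?_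
    · filter_upwards [(tendsto_expectile_atTop P hL h hl).eventually (eventually_gt_atTop 0)]
        with α hα
      exact mul_div_cancel₀ _ hα.ne'
    · filter_upwards [hq0] with α hα
      simp only [Pi.mul_apply]
      field_simp
  exact ⟨hei, hES.trans hTCE.symm, hTCE⟩

end Unbounded

section Bounded

variable {x : ℝ} (hx : ∀ t, 0 < lossTail P L t ↔ t < x)
  (hβ : Tendsto (fun t => stopLoss P L t / ((x - t) * lossTail P L t)) (tailFilter (lossTail P L))
    (𝓝 β))
include hx

theorem eventually_expectile_lt_endpoint : ∀ᶠ α in 𝓝[>] (0 : ℝ), expectile P L α < x :=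
  ((tendsto_expectile_tailFilter P hL h.neBot).eventually eventually_pos_tailFilter).mono
    fun _ hα => (hx _).1 hα

theorem tendsto_expectile_endpoint : Tendsto (expectile P L) (𝓝[>] 0) (𝓝 x) :=
  (tendsto_expectile_tailFilter P hL h.neBot).mono_right
    (tailFilter_le_nhds (lossTail_antitone P L) hx)

include hβ

theorem tendsto_sub_expectedShortfall_div :
    Tendsto (fun α => (x - expectedShortfall P L α) / (x - quantile P L α)) (𝓝[>] 0)
      (𝓝 (1 - β)) := by
  have hq := tendsto_quantile_tailFilter P L h.neBot
  have h1 := ((hβ.comp hq).mul (tendsto_lossTail_quantile_div P L h)).const_sub 1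
  rw [mul_one] at h1
  refine h1.congr' ?_
  filter_upwards [eventually_nhdsGT_zero_lt one_pos,
    hq.eventually eventually_pos_tailFilter] with α hα h3
  rw [expectedShortfall_eq P hL hα.1 hα.2]
  have := hα.1
  have h4 := sub_pos.2 ((hx _).1 h3)
  simp only [Function.comp]
  field_simp
  ring

theorem tendsto_sub_expectileTCE_div :
    Tendsto (fun α => (x - expectileTCE P L α) / (x - expectile P L α)) (𝓝[>] 0)
      (𝓝 (1 - β)) := by
  have he := tendsto_expectile_tailFilter P hL h.neBot
  refine ((hβ.comp he).const_sub 1).congr' ?_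
  filter_upwards [he.eventually eventually_pos_tailFilter] with α h3
  rw [expectileTCE_eq P hL h3]
  have h4 := sub_pos.2 ((hx _).1 h3)
  simp only [Function.comp]
  field_simp
  ring

/-- Now `e - E[L]` tends to the positive number `x - E[L]`, while `π(e)/G(e)` is of order at most `x
- e`, which vanishes. -/
theorem tendsto_div_lossTail_expectile_endpoint :
    Tendsto (fun α => α / lossTail P L (expectile P L α)) (𝓝[>] 0) (𝓝 0) := by
  have he := tendsto_expectile_tailFilter P hL h.neBot
  have hex := tendsto_expectile_endpoint P hL h hx
  have hμ : ∫ ω, L ω ∂P < x := by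
    obtain ⟨α, h1, h2⟩ := ((eventually_expectile_lt_endpoint P hL h hx).and
      (eventually_nhdsGT_zero_lt one_half_pos)).exists
    exact (mean_le_expectile P hL h2.1 h2.2.le).trans_lt h1
  have h2 := ((tendsto_one_sub_two_mul.mul (hβ.comp he)).mul (hex.const_sub x)).div
    (hex.sub_const (∫ ω, L ω ∂P)) (sub_pos.2 hμ).ne'
  rw [sub_self, mul_zero, zero_div] at h2
  refine h2.congr' ?_
  filter_upwards [he.eventually eventually_pos_tailFilter,
    hex.eventually (lt_mem_nhds hμ), eventually_nhdsGT_zero_lt one_half_pos] with α h5 h4 hα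
  have h6 := expectile_eq P hL hα.1 hα.2.le
  have h7 := sub_pos.2 h4
  have h8 := sub_pos.2 ((hx _).1 h5)
  simp only [Function.comp, Pi.div_apply]
  rw [div_eq_div_iff h7.ne' h5.ne']
  field_simp
  linear_combination h6

omit hβ in
theorem integrableOn_expectile_of_bounded :
    IntegrableOn (fun u => expectile P L u) (Set.Ioc 0 (1 / 2)) :=
  integrableOn_expectile P hL (g := fun _ => (1 : ℝ)) one_half_pos
    (integrableOn_const (by simp))
    ((tendsto_expectile_endpoint P hL h hx).isBigO_one ℝ)

omit hβ in
theorem isLittleO_sub_expectedShortfall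
    (hqe : (fun α => x - quantile P L α) =o[𝓝[>] 0] fun α => x - expectile P L α) :
    (fun α => (x - expectedShortfall P L α) / (x - expectileES P L α))
      =o[𝓝[>] 0] (fun _ => (1 : ℝ)) := by
  have hei := integrableOn_expectile_of_bounded P hL h hx
  have hqi : IntegrableOn (quantile P L) (Set.Ioc 0 (1 / 2)) :=
    (quantile_integral P hL one_half_pos one_half_lt_one).1
  have hxi : IntegrableOn (fun _ => x) (Set.Ioc (0 : ℝ) (1 / 2)) := integrableOn_const (by simp)
  have hmean : ∀ f : ℝ → ℝ, IntegrableOn f (Set.Ioc 0 (1 / 2)) → ∀ᶠ α in 𝓝[>] (0 : ℝ),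
      1 / α * (∫ u in (0 : ℝ)..α, (x - f u)) = x - 1 / α * ∫ u in (0 : ℝ)..α, f u := by
    intro f hf
    filter_upwards [eventually_nhdsGT_zero_lt one_half_pos] with α hα
    have i1 : IntervalIntegrable f volume 0 α :=
      (intervalIntegrable_iff_integrableOn_Ioc_of_le hα.1.le).2
        (hf.mono_set (Set.Ioc_subset_Ioc_right hα.2.le))
    rw [intervalIntegral.integral_sub intervalIntegrable_const i1,
      intervalIntegral.integral_const, smul_eq_mul, sub_zero, mul_sub, ← mul_assoc,
      one_div_mul_cancel hα.1.ne', one_mul]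
  have h1 := isLittleO_integral_of_isLittleO hqe
    ((eventually_expectile_lt_endpoint P hL h hx).mono fun α hα => (sub_pos.2 hα).le)
    one_half_pos (hxi.sub hei)
  have h2 := (isBigO_refl (fun α : ℝ => 1 / α) (𝓝[>] 0)).mul_isLittleO h1
  have h3 := h2.congr' (hmean _ hqi) (hmean _ hei)
  exact (isLittleO_one_iff ℝ).2 h3.tendsto_div_nhds_zero

end Bounded

end

end ExpectileRisk
-- The constant `β` and the comparison of expectile with quantile in the three domains.
namespace ExpectileRisk

section

variable {Ω : Type*} [MeasurableSpace Ω] (P : Measure Ω) [IsProbabilityMeasure P] {L : Ω → ℝ}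
  (hL : Integrable L P) {a : ℝ → ℝ}
include hL

section Frechet

variable {η : ℝ} (hη : 1 < η)
  (h : TailLimit (lossTail P L) a (Set.Ioi (-1)) fun z => (1 + z) ^ (-η))
  (hl : tailFilter (lossTail P L) = atTop)
include hη h hl

theorem frechet_stopLoss :
    Tendsto (fun t => stopLoss P L t / (t * lossTail P L t)) atTop (𝓝 (1 / (η - 1))) := by
  have hη0 : 0 < η := by linarith
  have hpos := h.frechet_pos hη0 (lossTail_nonneg P L)
  have hint : ∫ s in Set.Ioi (1 : ℝ), s ^ (-η) = 1 / (η - 1) := by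
    rw [integral_Ioi_rpow_of_lt (by linarith) one_pos, Real.one_rpow, ← neg_div_neg_eq]
    congr 1 <;> ring
  -- The exponent `(1 + η)/2` lies strictly between `1`, for integrability, and `η`, for `2^(-η) <
  -- 2^(-p)`.
  have := tendsto_setIntegral_Ioi_div (lossTail_antitone P L) hpos (p := (1 + η) / 2)
    (φ := fun s => s ^ (-η)) (by linarith)
    (fun s hs => hl ▸ h.frechet_regular hη0 hl (by linarith))
    (Real.rpow_lt_rpow_of_exponent_lt one_lt_two (by linarith))
  simpa only [hint, stopLoss_eq P hL] using this

/-- `G(e)/α → 1/β = η - 1` whereas `G(b q)/α → b^(-η)`. The limits agree exactly at `b = C`, and for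
other `b` their strict order decides on which side of `b q` the expectile lies. -/
theorem frechet_expectile_div_quantile :
    Tendsto (fun α => expectile P L α / quantile P L α) (𝓝[>] 0)
      (𝓝 ((η - 1) ^ (-(1 / η)))) := by
  have hη0 : 0 < η := by linarith
  have hη1 : 0 < η - 1 := by linarith
  set C := (η - 1) ^ (-(1 / η)) with hC
  have hC0 : 0 < C := Real.rpow_pos_of_pos hη1 _
  have hCη : C ^ (-η) = η - 1 := by
    rw [hC, ← Real.rpow_mul hη1.le]
    have : -(1 / η) * -η = 1 := by field_simp
    rw [this, Real.rpow_one]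
  have hq := tendsto_quantile_atTop P h hl
  have hβ := frechet_stopLoss P hL hη h hl
  have he : Tendsto (fun α => lossTail P L (expectile P L α) / α) (𝓝[>] 0) (𝓝 (η - 1)) := by
    simpa using (tendsto_div_lossTail_expectile P hL h hl hβ).inv₀ (by simp [hη1.ne'])
  have hqb : ∀ b > 0, Tendsto (fun α => lossTail P L (b * quantile P L α) / α) (𝓝[>] 0)
      (𝓝 (b ^ (-η))) := by
    intro b hb
    have h1 := ((h.frechet_regular hη0 hl hb).comp (tendsto_quantile_tailFilter P L h.neBot)).mul
      (tendsto_lossTail_quantile_div P L h)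
    rw [mul_one] at h1
    refine h1.congr' ?_
    filter_upwards [(tendsto_quantile_tailFilter P L h.neBot).eventually
      eventually_pos_tailFilter] with α hα
    exact div_mul_div_cancel₀ hα.ne'
  refine tendsto_order.2 ⟨fun b hb => ?_, fun b hb => ?_⟩
  · rcases le_or_gt b 0 with hb0 | hb0
    · filter_upwards [hq.eventually (eventually_gt_atTop 0),
        (tendsto_expectile_atTop P hL h hl).eventually (eventually_gt_atTop 0)] with α h1 h2
      exact hb0.trans_lt (div_pos h2 h1)
    · have hlt : η - 1 < b ^ (-η) := by
        rw [← hCη]; exact Real.rpow_lt_rpow_of_neg hb0 hb (by linarith)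
      filter_upwards [hq.eventually (eventually_gt_atTop 0), he.eventually_lt (hqb b hb0) hlt,
        eventually_nhdsGT_zero_lt one_pos] with α h1 h2 hα
      rw [lt_div_iff₀ h1]
      exact (lossTail_antitone P L).reflect_lt ((div_lt_div_iff_of_pos_right hα.1).1 h2)
  · have hlt : b ^ (-η) < η - 1 := by
      rw [← hCη]; exact Real.rpow_lt_rpow_of_neg hC0 hb (by linarith)
    filter_upwards [hq.eventually (eventually_gt_atTop 0),
      (hqb b (hC0.trans hb)).eventually_lt he hlt,
      eventually_nhdsGT_zero_lt one_pos] with α h1 h2 hα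
    rw [div_lt_iff₀ h1]
    exact (lossTail_antitone P L).reflect_lt ((div_lt_div_iff_of_pos_right hα.1).1 h2)

end Frechet

section Weibull

variable {η : ℝ} (hη : 0 < η) {x : ℝ} (hx : ∀ t, 0 < lossTail P L t ↔ t < x)
  (h : TailLimit (lossTail P L) a (Set.Iio 1) fun z => (1 - z) ^ η)
include hη h hx

theorem weibull_stopLoss :
    Tendsto (fun t => stopLoss P L t / ((x - t) * lossTail P L t)) (tailFilter (lossTail P L))
      (𝓝 (1 / (η + 1))) := by
  have hint : ∫ s in (0 : ℝ)..1, s ^ η = 1 / (η + 1) := by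
    rw [integral_rpow (Or.inl (by linarith)), Real.one_rpow, Real.zero_rpow (by linarith), sub_zero]
  have := tendsto_setIntegral_Ioi_div_endpoint (lossTail_antitone P L) (lossTail_nonneg P L) hx
    (φ := fun s => s ^ η) fun s hs => h.weibull_regular hη hx hs.1
  simpa only [hint, stopLoss_eq P hL] using this

/-- The tail at `x - δ(x - e)` is about `δ^η G(e)`, and `α` is negligible against `G(e)`; so this
point lies below `q`, for every `δ > 0`. -/
theorem weibull_isLittleO :
    (fun α => x - quantile P L α) =o[𝓝[>] 0] fun α => x - expectile P L α := by
  refine isLittleO_iff.2 fun δ hδ => ?_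
  have he := tendsto_expectile_tailFilter P hL h.neBot
  have hq := tendsto_quantile_tailFilter P L h.neBot
  filter_upwards [(tendsto_div_lossTail_expectile_endpoint P hL h hx
      (weibull_stopLoss P hL hη hx h)).eventually_lt
      ((h.weibull_regular hη hx hδ).comp he) (Real.rpow_pos_of_pos hδ η),
    he.eventually eventually_pos_tailFilter, hq.eventually eventually_pos_tailFilter,
    eventually_nhdsGT_zero_lt one_pos] with α h1 h2 h3 hα
  have h4 := (lt_quantile_iff P L hα.1 hα.2).2 ((div_lt_div_iff_of_pos_right h2).1 h1)
  have h5 := sub_pos.2 ((hx _).1 h2)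
  have h6 := sub_pos.2 ((hx _).1 h3)
  rw [Real.norm_of_nonneg h5.le, Real.norm_of_nonneg h6.le]
  linarith

end Weibull

section Gumbel

variable (h : TailLimit (lossTail P L) a Set.univ fun z => Real.exp (-z))
include h

theorem gumbel_stopLoss_endpoint {x : ℝ} (hx : ∀ t, 0 < lossTail P L t ↔ t < x) :
    Tendsto (fun t => stopLoss P L t / ((x - t) * lossTail P L t)) (tailFilter (lossTail P L))
      (𝓝 0) := by
  have := tendsto_setIntegral_Ioi_div_endpoint (lossTail_antitone P L) (lossTail_nonneg P L) hx
    (φ := fun _ => 0) fun s hs => h.gumbel_rapid_endpoint (lossTail_nonneg P L) hx hs.2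
  simpa only [intervalIntegral.integral_zero, stopLoss_eq P hL] using this

variable (hl : tailFilter (lossTail P L) = atTop)
include hl

theorem gumbel_stopLoss (hpos : ∀ t, 0 < lossTail P L t) :
    Tendsto (fun t => stopLoss P L t / (t * lossTail P L t)) atTop (𝓝 0) := by
  have := tendsto_setIntegral_Ioi_div (lossTail_antitone P L) hpos (p := 2)
    (φ := fun _ => 0) one_lt_two
    (fun s hs => hl ▸ h.gumbel_rapid (lossTail_nonneg P L) hl hs) (by positivity)
  simpa only [integral_zero, stopLoss_eq P hL] using this

/-- For `b > 1`, `G(b q) < α < G(e)` eventually, since `β = 0`. For `b < 1` this limit gives no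
information, so `b q` is tested directly in the expectile equation. -/
theorem gumbel_expectile_div_quantile (hpos : ∀ t, 0 < lossTail P L t) :
    Tendsto (fun α => expectile P L α / quantile P L α) (𝓝[>] 0) (𝓝 1) := by
  have hq := tendsto_quantile_atTop P h hl
  have hβ := gumbel_stopLoss P hL h hl hpos
  have hqα := tendsto_lossTail_quantile_div P L h
  refine tendsto_order.2 ⟨fun b hb => ?_, fun b hb => ?_⟩
  · rcases le_or_gt b 0 with hb0 | hb0
    · filter_upwards [hq.eventually (eventually_gt_atTop 0),
        (tendsto_expectile_atTop P hL h hl).eventually (eventually_gt_atTop 0)] with α h1 h2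
      exact hb0.trans_lt (div_pos h2 h1)
    -- The intermediate `d` gives the Markov bound `π(b q) ≥ (d - b) q G(d q)`, and `α = o(G(d q))`
    -- because `d < 1`; hence `π(b q)` outweighs `α b q`.
    · obtain ⟨d, hbd, hd1⟩ := exists_between hb
      have hd0 : 0 < d := hb0.trans hbd
      have h1 : Tendsto (fun α => lossTail P L (quantile P L α) / lossTail P L (d * quantile P L α))
          (𝓝[>] 0) (𝓝 0) := by
        have h2 : Tendsto (fun α => d * quantile P L α) (𝓝[>] 0) (tailFilter (lossTail P L)) := by
          rw [hl]; exact hq.const_mul_atTop hd0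
        refine ((h.gumbel_rapid (lossTail_nonneg P L) hl
          ((one_lt_inv₀ hd0).2 hd1)).comp h2).congr fun α => ?_
        simp only [Function.comp]
        rw [inv_mul_cancel_left₀ hd0.ne']
      have h3 : Tendsto (fun α => α / lossTail P L (d * quantile P L α)) (𝓝[>] 0) (𝓝 0) := by
        have := h1.div hqα one_ne_zero
        rw [zero_div] at this
        refine this.congr' ?_
        filter_upwards [eventually_nhdsGT_zero_lt one_pos] with α hα
        have h4 := hpos (quantile P L α)
        have h5 := hpos (d * quantile P L α)
        have h6 := hα.1
        simp only [Pi.div_apply]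
        field_simp
      have h7 : Tendsto (fun α => b - (∫ ω, L ω ∂P) / quantile P L α) (𝓝[>] 0) (𝓝 b) := by
        simpa using (hq.const_div_atTop (∫ ω, L ω ∂P)).const_sub b
      have h8 := h3.mul h7
      have h9 := tendsto_one_sub_two_mul.mul_const (d - b)
      rw [zero_mul] at h8
      rw [one_mul] at h9
      filter_upwards [h8.eventually_lt h9 (sub_pos.2 hbd), hq.eventually (eventually_gt_atTop 0),
        eventually_nhdsGT_zero_lt one_half_pos] with α h10 h11 hα
      rw [lt_div_iff₀ h11, lt_expectile_iff P hL hα.1 hα.2.le]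
      have h12 := hpos (d * quantile P L α)
      have h13 := mul_lossTail_le_stopLoss P hL (mul_le_mul_of_nonneg_right hbd.le h11.le)
      have h14 := mul_lt_mul_of_pos_right h10 (mul_pos h12 h11)
      have h15 : α / lossTail P L (d * quantile P L α) * (b - (∫ ω, L ω ∂P) / quantile P L α) *
          (lossTail P L (d * quantile P L α) * quantile P L α) =
          α * (b * quantile P L α - ∫ ω, L ω ∂P) := by
        field_simp
      have h16 := mul_le_mul_of_nonneg_left h13 (show 0 ≤ 1 - 2 * α by linarith [hα.2])
      rw [h15] at h14
      linarith
  · have h1 : Tendsto (fun α => lossTail P L (b * quantile P L α) / α) (𝓝[>] 0) (𝓝 0) := by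
      have h2 := ((h.gumbel_rapid (lossTail_nonneg P L) hl hb).comp
        (tendsto_quantile_tailFilter P L h.neBot)).mul hqα
      rw [zero_mul] at h2
      refine h2.congr fun α => ?_
      exact div_mul_div_cancel₀ (hpos _).ne'
    filter_upwards [hq.eventually (eventually_gt_atTop 0),
      h1.eventually (gt_mem_nhds one_pos),
      (tendsto_div_lossTail_expectile P hL h hl hβ).eventually (gt_mem_nhds one_pos),
      eventually_nhdsGT_zero_lt one_pos] with α h2 h3 h4 hα
    rw [div_lt_iff₀ h2]
    rw [div_lt_one hα.1] at h3
    rw [div_lt_one (hpos _)] at h4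
    exact (lossTail_antitone P L).reflect_lt (h3.trans h4)

end Gumbel

end

end ExpectileRisk

/-! ### The three cases assembled. -/

theorem proposition4p3 {Ω : Type*} [MeasurableSpace Ω] (P : Measure Ω) [IsProbabilityMeasure P]
    (L : Ω → ℝ) (hL : Integrable L P)
    (hpos : 0 < rightEndpoint (lossCDF P L)) :
    -- (i) Fréchet
    (∀ η : ℝ, 1 < η →
      MDA (lossCDF P L) (frechetCDF η) →
      IntegrableOn (fun u => expectile P L u) (Set.Ioc 0 (1 / 2)) ∧
      (fun α => expectileES P L α) ~[𝓝[>] 0]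
        (fun α => expectileTCE P L α) ∧
      (fun α => expectileTCE P L α) ~[𝓝[>] 0]
        (fun α => (η - 1) ^ (-(1 / η)) * expectedShortfall P L α) ∧
      (fun α => expectileTCE P L α / expectile P L α) ~[𝓝[>] 0]
        (fun α => expectedShortfall P L α / quantile P L α)) ∧
    -- (ii) Weibull
    (∀ η : ℝ, 0 < η →
      MDA (lossCDF P L) (weibullCDF η) →
      IntegrableOn (fun u => expectile P L u) (Set.Ioc 0 (1 / 2)) ∧
      ∃ x : ℝ, rightEndpoint (lossCDF P L) = (x : EReal) ∧
        (fun α => (x - expectedShortfall P L α) /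
            (x - expectileES P L α)) =o[𝓝[>] 0] (fun _ => (1 : ℝ)) ∧
        (fun α => (x - expectileTCE P L α) /
            (x - expectile P L α)) ~[𝓝[>] 0]
          (fun α => (x - expectedShortfall P L α) /
            (x - quantile P L α))) ∧
    -- (iii) Gumbel
    (MDA (lossCDF P L) gumbelCDF →
      (rightEndpoint (lossCDF P L) = ⊤ →
        (fun α => expectileTCE P L α / expectile P L α) ~[𝓝[>] 0]
          (fun α => expectedShortfall P L α / quantile P L α)) ∧
      (∀ x : ℝ, rightEndpoint (lossCDF P L) = (x : EReal) →
        (fun α => (x - expectileTCE P L α) /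
            (x - expectile P L α)) ~[𝓝[>] 0]
          (fun α => (x - expectedShortfall P L α) /
            (x - quantile P L α))) ∧
      (∀ (τ c : ℝ) (r : ℝ → ℝ), 0 < τ → 0 < c → SlowlyVarying r →
        (∀ᶠ x : ℝ in atTop,
          lossCDF P L x = 1 - Real.exp (-(x ^ τ * r x))) →
        Tendsto (fun x : ℝ => (r (c * x) / r x - 1) * Real.log (r x)) atTop (𝓝 0) →
        IntegrableOn (fun u => expectile P L u) (Set.Ioc 0 (1 / 2)) ∧
        (fun α => expectileES P L α) ~[𝓝[>] 0]
          (fun α => expectileTCE P L α) ∧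
        (fun α => expectileTCE P L α) ~[𝓝[>] 0]
          (fun α => expectedShortfall P L α))) := by
  refine ⟨fun η hη hM => ?_, fun η hη hM => ?_, fun hM => ⟨fun htop => ?_, fun x hx => ?_, ?_⟩⟩
  · obtain ⟨a, h⟩ := exists_tailLimit_frechet P L (by linarith) hM
    have hη1 : 0 < η - 1 := by linarith
    have hl := tailFilter_eq_atTop (lossTail_antitone P L)
      (h.frechet_pos (by linarith) (lossTail_nonneg P L)) (tendsto_lossTail_atTop P L)
    have hβ := frechet_stopLoss P hL hη h hl
    -- A common limit yields asymptotic equivalence only when it is nonzero.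
    have hβ1 : 1 + 1 / (η - 1) ≠ 0 := by positivity
    obtain ⟨h1, h2, h3⟩ := expectileES_isEquivalent_of_tendsto P hL h hl hβ
      (Real.rpow_pos_of_pos hη1 _) hβ1 (frechet_expectile_div_quantile P hL hη h hl)
    exact ⟨h1, h2, h3, isEquivalent_of_tendsto_const hβ1
      (tendsto_expectileTCE_div_expectile P hL h hl hβ)
      (tendsto_expectedShortfall_div_quantile P hL h hl hβ)⟩
  · obtain ⟨a, h⟩ := exists_tailLimit_weibull P L hη hM
    have hne := h.neBot
    obtain ⟨t, ht⟩ := (h.weibull_le hη one_pos).exists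
    obtain ⟨x, hx⟩ := exists_rightEndpoint_eq P L (B := t + (1 + 1) * a t)
      fun s hs => by linarith [ht s hs]
    have hx' := lossTail_pos_iff P L hx
    have hβ := weibull_stopLoss P hL hη hx' h
    have hβ1 : 1 - 1 / (η + 1) ≠ 0 := by
      have : 1 - 1 / (η + 1) = η / (η + 1) := by field_simp; ring
      rw [this]
      positivity
    exact ⟨integrableOn_expectile_of_bounded P hL h hx', x, hx,
      isLittleO_sub_expectedShortfall P hL h hx' (weibull_isLittleO P hL hη hx' h),
      isEquivalent_of_tendsto_const hβ1 (tendsto_sub_expectileTCE_div P hL h hx' hβ)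
        (tendsto_sub_expectedShortfall_div P hL h hx' hβ)⟩
  · obtain ⟨a, h⟩ := exists_tailLimit_gumbel P L hM
    have hpos : ∀ t, 0 < lossTail P L t := fun t =>
      lossTail_pos_of_rightEndpoint P L (htop ▸ EReal.coe_lt_top t)
    have hl := tailFilter_eq_atTop (lossTail_antitone P L) hpos (tendsto_lossTail_atTop P L)
    have hβ := gumbel_stopLoss P hL h hl hpos
    exact isEquivalent_of_tendsto_const (by norm_num)
      (tendsto_expectileTCE_div_expectile P hL h hl hβ)
      (tendsto_expectedShortfall_div_quantile P hL h hl hβ)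
  · obtain ⟨a, h⟩ := exists_tailLimit_gumbel P L hM
    have hx' := lossTail_pos_iff P L hx
    have hβ := gumbel_stopLoss_endpoint P hL h hx'
    exact isEquivalent_of_tendsto_const (by norm_num)
      (tendsto_sub_expectileTCE_div P hL h hx' hβ)
      (tendsto_sub_expectedShortfall_div P hL h hx' hβ)
  · -- only unboundedness of the loss is needed here: rapid variation already gives `e_α ~ q_α`
    intro τ c r _ _ _ hF _
    obtain ⟨a, h⟩ := exists_tailLimit_gumbel P L hM
    have hpos : ∀ t, 0 < lossTail P L t := by
      intro t
      obtain ⟨s, hs, hts⟩ := (hF.and (eventually_ge_atTop t)).exists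
      refine lt_of_lt_of_le ?_ (lossTail_antitone P L hts)
      rw [lossTail, hs, sub_sub_cancel]
      exact Real.exp_pos _
    have hl := tailFilter_eq_atTop (lossTail_antitone P L) hpos (tendsto_lossTail_atTop P L)
    have hβ := gumbel_stopLoss P hL h hl hpos
    simpa using expectileES_isEquivalent_of_tendsto P hL h hl hβ one_pos (by norm_num)
      (gumbel_expectile_div_quantile P hL h hl hpos)
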